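/- Let $\mathbb K$ be an algebraically closed field and let $N,c,r\ge 0$ be integers with $N\ge 2$, $2c+r\ge N$ and $c+r\le N-1$; put $n=N-(c+r)\ge 1$. Let $\lambda_0,\dots,\lambda_N\ge 2$ be integers and, for $i=1,\dots,c+r$, let $$F_i=\sum_{j=0}^N A_i^j\,z_j^{\lambda_j}\in\mathbb K[z_0,\dots,z_N],$$ where the $A_i^j$ are homogeneous polynomials with $\deg A_i^j+\lambda_j=\deg F_i$ for all $i,j$. Suppose that $V=\{F_1=\dots=F_c=0\}$ and $X=\{F_1=\dots=F_{c+r}=0\}$ are smooth complete intersections in $\mathbb P^N=\mathbb P^N_{\mathbb K}$. Varieties are taken in the classical sense (sets of closed points). Let $\pi:\mathbb K^{N+1}\setminus\{0\}\to\mathbb P^N$ be the projection and write $\widehat S=\pi^{-1}(S)$ for $S\subset\mathbb P^N$. The horizontal tangent bundle $\mathrm T_{\rm hor}\widehat V$ has the fibre $$\mathrm T_{\rm hor}\widehat V|_z=\{[\xi]\in\mathbb K^{N+1}/\mathbb K z\,:\,dF_i|_z(\xi)=0,\ i=1,\dots,c\}$$ at $z\in\widehat V$, and $\Omega_{\rm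 hor}\widehat V$ denotes its dual; $\mathrm T_V=\mathrm T_{\rm hor}\widehat V/\!\sim$ with $(z,[\xi])\sim(a z,[a\xi])$, $a\in\mathbb K^\times$. For $Y\subset V$, $l\ge1$ and $k\in\mathbb Z$, pull-back along $\pi$ is a canonical injection $$\Gamma\big(Y,\mathrm{Sym}^{l}\Omega_V(k)\big)\hookrightarrow\Gamma\big(\widehat Y,\mathrm{Sym}^{l}\Omega_{\rm hor}\widehat V\big),$$ where sections of $\mathcal O(k)$ are seen as functions on cones which are homogeneous of degree $k$. Let $\mathsf C$ be the $(c+r+c)\times(N+1)$ matrix whose first $c+r$ rows are $(A_i^jz_j)_{0\le j\le N}$, $i=1,\dots,c+r$, and whose last $c$ rows are the rows of $1$-forms $(z_j\,dA_i^j+\lambda_jA_i^j\,dz_j)_{0\le j\le N}$, $i=1,\dots,c$. Let $1\le\eta\le n-1$, let $0\le v_1<\dots<v_\eta\le N$, let $r_0<\dots<r_{N-\eta}$ be the elements of $\{0,\dots,N\}\setminus\{v_1,\dots,v_\eta\}$, and put $$Y=X\cap\{z_{v_1}=0\}\cap\dots\cap\{z_{v_\eta}=0\}.$$ Let $l_1\ge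 l_2\ge1$ be integers with $l_1+l_2=N-\eta$ and let $1\le i_1<\dots<i_{l_1}\le c+r$ and $1\le j_1<\dots<j_{l_2}\le c$ be such that $\{j_1,\dots,j_{l_2}\}\subset\{i_1,\dots,i_{l_1}\}$. For $t=0,\dots,N-\eta$ let $\widehat{\mathsf C}_t$ be the $(N-\eta)\times(N-\eta)$ submatrix of $\mathsf C$ with the rows $i_1,\dots,i_{l_1},c+r+j_1,\dots,c+r+j_{l_2}$ and the columns of the variables $z_{r_0},\dots,z_{r_{N-\eta}}$ except $z_{r_t}$. Then the formulas $$\widehat\omega_t=\frac{(-1)^t}{z_{r_t}^{\lambda_{r_t}-1}}\det\widehat{\mathsf C}_t\in\Gamma\big(\widehat Y\cap\{z_{r_t}\ne0\},\mathrm{Sym}^{l_2}\Omega_{\rm hor}\widehat V\big),\qquad t=0,\dots,N-\eta,$$ give well-defined regular symmetric horizontal differential $l_2$-forms, these glue to a unique regular form $\widehat\omega\in\Gamma(\widehat Y,\mathrm{Sym}^{l_2}\Omega_{\rm hor}\widehat V)$, and $\widehat\omega$ is the image under the canonical injection of a twisted regular symmetric differential $l_2$-form $$\omega\in\Gamma\big(Y,\mathrm{Sym}^{l_2}\Omega_V(\heartsuit)\big),\qquad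 \heartsuit=\sum_{p=1}^{l_1}\deg F_{i_p}+\sum_{q=1}^{l_2}\deg F_{j_q}-\Big(\sum_{j=0}^N\lambda_j-\sum_{\mu=1}^\eta\lambda_{v_\mu}\Big)+(N-\eta)+1.$$ Furthermore, for every homogeneous polynomial $P\in\mathbb K[z_0,\dots,z_N]$, multiplication gives a form $P\,\omega\in\Gamma\big(Y,\mathrm{Sym}^{l_2}\Omega_V(\deg P+\heartsuit)\big)$, whose image under the canonical injection is $P\,\widehat\omega$. -/

import Mathlib

open scoped TensorProduct LinearAlgebra.Projectivization

noncomputable section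

namespace FermatForms

/-! ### Symmetric powers of a cotangent space -/

section SymPower

variable (K : Type*) [Field K] (l : ℕ)

/-- `Sym^l (T^*)`, for a finite-dimensional vector space `T` over an infinite field, realised as the
space of homogeneous polynomial functions of degree `l` on `T`: the span of the products of `l`
linear forms. (The canonical map from the abstract symmetric power of the dual to functions is
injective over an infinite field, and this is its image.) -/
def SymForm (T : Type*) [AddCommGroup T] [Module K T] : Submodule K (T → K) :=
  Submodule.span K
    (Set.range fun (φ : Fin l → Module.Dual K T) (t : T) => ∏ m, φ m t)

variable {K l} {T T' : Type*} [AddCommGroup T] [Module K T] [AddCommGroup T'] [Module K T']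

/-- The symmetric product `φ₁ ⋯ φ_l` of `l` linear forms. -/
def SymForm.prod (φ : Fin l → Module.Dual K T) : SymForm K l T :=
  ⟨fun t => ∏ m, φ m t, Submodule.subset_span ⟨φ, rfl⟩⟩

/-- Pull-back of symmetric forms along a linear map. -/
def SymForm.comap (L : T →ₗ[K] T') : SymForm K l T' →ₗ[K] SymForm K l T where
  toFun s := ⟨fun t => s.1 (L t), by
    have h : SymForm K l T' ≤ (SymForm K l T).comap (LinearMap.funLeft K K L) := by
      refine Submodule.span_le.2 ?_
      rintro _ ⟨φ, rfl⟩
      exact Submodule.subset_span ⟨fun m => (φ m).comp L, rfl⟩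
    exact h s.2⟩
  map_add' _ _ := rfl
  map_smul' _ _ := rfl

theorem SymForm.comap_injective (L : T →ₗ[K] T') (hL : Function.Surjective L) :
    Function.Injective (SymForm.comap (l := l) L) := by
  intro s s' h
  ext t
  obtain ⟨t, rfl⟩ := hL t
  exact congrFun (congrArg Subtype.val h) t

end SymPower

/-! ### Projective space, cones, zero sets, tangent spaces -/

section Geometry

/-- The nonzero vectors of `K^{N+1}`. -/
abbrev Vec (K : Type*) [Field K] (N : ℕ) := {z : Fin (N + 1) → K // z ≠ 0}

/-- Projective space `ℙ^N` over `K`, as the set of lines in `K^{N+1}`. -/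
abbrev PP (K : Type*) [Field K] (N : ℕ) := ℙ K (Fin (N + 1) → K)

variable {K : Type*} [Field K] {N : ℕ}

/-- The projection `π : K^{N+1} ∖ {0} → ℙ^N`. -/
def proj (z : Vec K N) : PP K N := Projectivization.mk K z.1 z.2

/-- `z` as a vector of the line through `z`. -/
def lineVec (z : Vec K N) : (proj z).submodule :=
  ⟨z.1, Submodule.mem_span_singleton_self z.1⟩

/-- The cone `π⁻¹(Y)`. -/
def cone (Y : Set (PP K N)) : Set (Vec K N) := proj ⁻¹' Y

/-- A family of homogeneous polynomials in `z_0, …, z_N`. -/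
structure System (K : Type*) [Field K] (N : ℕ) (ι : Type*) where
  poly : ι → MvPolynomial (Fin (N + 1)) K
  deg : ι → ℕ
  isHomogeneous : ∀ i, (poly i).IsHomogeneous (deg i)

/-- The subfamily (or re-indexed family) along a map of index types. -/
def System.reindex {ι ι' : Type*} (G : System K N ι) (f : ι' → ι) : System K N ι' where
  poly i := G.poly (f i)
  deg i := G.deg (f i)
  isHomogeneous i := G.isHomogeneous (f i)

/-- The common zero set in `ℙ^N` of a family of homogeneous polynomials. -/
def System.zeroSet {ι : Type*} (G : System K N ι) : Set (PP K N) :=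
  {p | ∀ i, ∀ w ∈ p.submodule, MvPolynomial.eval w (G.poly i) = 0}

/-- `Y ∩ {z_{v_1} = 0} ∩ … ∩ {z_{v_η} = 0}`. -/
def coordSection {η : ℕ} (v : Fin η → Fin (N + 1)) (Y : Set (PP K N)) : Set (PP K N) :=
  {p | p ∈ Y ∧ ∀ μ, ∀ w ∈ p.submodule, w (v μ) = 0}

/-- The value at `z` of the differential `dP`, a linear form on `K^{N+1}`. -/
def differential (P : MvPolynomial (Fin (N + 1)) K) (z : Fin (N + 1) → K) :
    Module.Dual K (Fin (N + 1) → K) :=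
  ∑ k, MvPolynomial.eval z (MvPolynomial.pderiv k P) • LinearMap.proj k

variable {ι : Type*} (G : System K N ι)

/-- The hypersurfaces `G_i = 0` form a smooth complete intersection in `ℙ^N`
(Jacobian criterion). -/
def System.IsSmoothCompleteIntersection : Prop :=
  ∀ z : Vec K N, proj z ∈ G.zeroSet →
    LinearIndependent K fun i => differential (G.poly i) z.1

/-- The space of `ξ ∈ K^{N+1}` with `dG_i|_z (ξ) = 0` for all `i`. -/
def affineTangent (z : Fin (N + 1) → K) : Submodule K (Fin (N + 1) → K) :=
  ⨅ i, LinearMap.ker (differential (G.poly i) z)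

/-- For `V = {G = 0}` and `z` in its cone `V̂`, the horizontal tangent space
`T_hor V̂|_z = {[ξ] ∈ K^{N+1} / K z : dG_i|_z (ξ) = 0}`. -/
def horTangent (z : Vec K N) : Submodule K ((Fin (N + 1) → K) ⧸ (proj z).submodule) :=
  (affineTangent G z.1).map (proj z).submodule.mkQ

/-- The tangent space at `p` of `V = {G = 0} ⊆ ℙ^N`, as a subspace of
`T_p ℙ^N = Hom (ℓ, K^{N+1} / ℓ)` with `ℓ` the line of `p`. The class of `(z, [ξ])` modulo
`(z, [ξ]) ∼ (a z, [a ξ])` corresponds to the linear map with `z ↦ [ξ]`. -/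
def tangent (p : PP K N) :
    Submodule K (p.submodule →ₗ[K] ((Fin (N + 1) → K) ⧸ p.submodule)) where
  carrier := {φ | ∀ w : p.submodule, φ w ∈ (affineTangent G w.1).map p.submodule.mkQ}
  add_mem' h h' w := add_mem (h w) (h' w)
  zero_mem' _ := zero_mem _
  smul_mem' a _ h w := Submodule.smul_mem _ a (h w)

theorem eval_smul_of_isHomogeneous {P : MvPolynomial (Fin (N + 1)) K} {d : ℕ}
    (hP : P.IsHomogeneous d) (a : K) (z : Fin (N + 1) → K) :
    MvPolynomial.eval (a • z) P = a ^ d * MvPolynomial.eval z P := by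
  rw [MvPolynomial.eval_eq, MvPolynomial.eval_eq, Finset.mul_sum]
  refine Finset.sum_congr rfl fun m hm => ?_
  have h := hP (MvPolynomial.mem_support_iff.1 hm)
  rw [Finsupp.weight_apply, Finsupp.sum] at h
  simp only [Pi.smul_apply, smul_eq_mul, mul_pow, Finset.prod_mul_distrib,
    Finset.prod_pow_eq_pow_sum, Pi.one_apply, mul_one] at h ⊢
  rw [h]
  ring

theorem affineTangent_le_smul (a : K) (z : Fin (N + 1) → K) :
    affineTangent G z ≤ affineTangent G (a • z) := by
  intro ξ hξ
  simp only [affineTangent, Submodule.mem_iInf, LinearMap.mem_ker, differential,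
    LinearMap.coe_sum, Finset.sum_apply, LinearMap.smul_apply, LinearMap.proj_apply,
    smul_eq_mul] at hξ ⊢
  intro i
  simp only [eval_smul_of_isHomogeneous (G.isHomogeneous i).pderiv, mul_assoc]
  rw [← Finset.mul_sum, hξ i, mul_zero]

/-- The coordinate of the vectors of the line through `z` in the basis `z`. -/
def lineCoord (z : Vec K N) : (proj z).submodule ≃ₗ[K] K :=
  LinearEquiv.coord K (Fin (N + 1) → K) z.1 z.2

theorem lineCoord_lineVec (z : Vec K N) : lineCoord z (lineVec z) = 1 :=
  LinearEquiv.coord_self K _ z.1 z.2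

theorem lineCoord_smul (z : Vec K N) (w : (proj z).submodule) :
    lineCoord z w • z.1 = w.1 :=
  LinearEquiv.toSpanNonzeroSingleton_symm_apply_smul K _ z.1 z.2 w

/-- The differential `T_hor V̂|_z → T_V|_[z]` of the projection `π : V̂ → V`, which takes `[ξ]` to
the class of `(z, [ξ])`, that is to the linear map with `z ↦ [ξ]`. -/
def dproj (z : Vec K N) : horTangent G z →ₗ[K] tangent G (proj z) where
  toFun t := ⟨(lineCoord z).toLinearMap.smulRight t.1, fun w => by
    obtain ⟨ξ, hξ, h⟩ := t.2
    refine ⟨lineCoord z w • ξ, ?_, ?_⟩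
    · rw [← lineCoord_smul z w]
      exact Submodule.smul_mem _ _ (affineTangent_le_smul G _ _ hξ)
    · rw [map_smul, h]; rfl⟩
  map_add' t t' := by ext w; simp
  map_smul' a t := by
    ext w
    simp only [LinearMap.smulRight_apply, Submodule.coe_smul, RingHom.id_apply,
      LinearMap.smul_apply]
    exact smul_comm _ _ _

theorem dproj_surjective (z : Vec K N) : Function.Surjective (dproj G z) := by
  intro φ
  refine ⟨⟨φ.1 (lineVec z), φ.2 (lineVec z)⟩, ?_⟩
  ext1
  refine LinearMap.ext fun w => ?_
  change lineCoord z w • φ.1 (lineVec z) = φ.1 w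
  rw [← map_smul]
  congr 1
  exact Subtype.ext (lineCoord_smul z w)

/-! ### Symmetric horizontal forms on cones -/

/-- The class `[ξ]` in `T_hor V̂|_z` of a vector `ξ` with `dG_i|_z (ξ) = 0`. -/
def horClass (z : Vec K N) (ξ : affineTangent G z.1) : horTangent G z :=
  ⟨(proj z).submodule.mkQ ξ.1, Submodule.mem_map_of_mem ξ.2⟩

/-- `Γ(S, Sym^l Ω_hor V̂)` for a Zariski locally closed subset `S` of `V̂`: families of elements of
the fibres `Sym^l (T_hor V̂|_z)^*`, `z ∈ S`, which are regular, that is, which Zariski-locally on `S`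
are of the form `(z, [ξ]) ↦ (∑_α H_α(z) ξ_{α_1} ⋯ ξ_{α_l}) / g(z)` with polynomials
`H_α` and `g`. -/
def HorSection (l : ℕ) (S : Set (Vec K N)) :
    Submodule K ((z : S) → SymForm K l (horTangent G z.1)) where
  carrier := {ω | ∀ z₀ : S, ∃ (g : MvPolynomial (Fin (N + 1)) K)
    (H : (Fin l → Fin (N + 1)) → MvPolynomial (Fin (N + 1)) K),
    MvPolynomial.eval z₀.1.1 g ≠ 0 ∧
    ∀ z : S, MvPolynomial.eval z.1.1 g ≠ 0 → ∀ ξ : affineTangent G z.1.1,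
      (ω z).1 (horClass G z.1 ξ) =
        (∑ α, MvPolynomial.eval z.1.1 (H α) * ∏ m, ξ.1 (α m)) / MvPolynomial.eval z.1.1 g}
  add_mem' := by
    intro ω ω' h h' z₀
    obtain ⟨g, H, hg, hH⟩ := h z₀
    obtain ⟨g', H', hg', hH'⟩ := h' z₀
    refine ⟨g * g', fun α => H α * g' + H' α * g, ?_, fun z hz ξ => ?_⟩
    · simpa using ⟨hg, hg'⟩
    · rw [map_mul] at hz
      have h1 := left_ne_zero_of_mul hz
      have h2 := right_ne_zero_of_mul hz
      change (ω z).1 _ + (ω' z).1 _ = _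
      rw [hH z h1, hH' z h2]
      simp only [map_add, map_mul, add_mul, Finset.sum_add_distrib]
      rw [div_add_div _ _ h1 h2, Finset.sum_mul, Finset.mul_sum]
      congr 2 <;> exact Finset.sum_congr rfl fun α _ => by ring
  zero_mem' z₀ := ⟨1, 0, by simp, fun z _ ξ => by simp⟩
  smul_mem' := by
    intro a ω h z₀
    obtain ⟨g, H, hg, hH⟩ := h z₀
    refine ⟨g, fun α => MvPolynomial.C a * H α, hg, fun z hz ξ => ?_⟩
    change a * (ω z).1 _ = _
    rw [hH z hz]
    simp only [map_mul, MvPolynomial.eval_C, mul_assoc]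
    rw [← Finset.mul_sum, mul_div_assoc]

/-- The value `ω(z, [ξ])` of a section. -/
def HorSection.val {l : ℕ} {S : Set (Vec K N)} (ω : HorSection G l S) (z : S)
    (ξ : affineTangent G z.1.1) : K :=
  (ω.1 z).1 (horClass G z.1 ξ)

/-- Restriction of sections to a subset. -/
def HorSection.restrict {l : ℕ} {S S' : Set (Vec K N)} (h : S' ⊆ S) (ω : HorSection G l S) :
    HorSection G l S' :=
  ⟨fun z => ω.1 ⟨z.1, h z.2⟩, fun z₀ => by
    obtain ⟨g, H, hg, hH⟩ := ω.2 ⟨z₀.1, h z₀.2⟩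
    exact ⟨g, H, hg, fun z => hH ⟨z.1, h z.2⟩⟩⟩

/-! ### Twisted symmetric forms on subsets of `V` -/

/-- The fibre of `𝓞(k)` at `p`: the functions on the nonzero vectors of the line of `p` which are
homogeneous of degree `k`. -/
def Twist (k : ℤ) (p : PP K N) : Submodule K ({w : p.submodule // w ≠ 0} → K) where
  carrier := {f | ∀ (a : Kˣ) (w w' : {w : p.submodule // w ≠ 0}),
    w'.1 = (a : K) • w.1 → f w' = (a : K) ^ k * f w}
  add_mem' h h' a w w' e := by
    rw [Pi.add_apply, Pi.add_apply, h a w w' e, h' a w w' e, mul_add]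
  zero_mem' _ _ _ _ := by simp
  smul_mem' b _ h a w w' e := by
    rw [Pi.smul_apply, Pi.smul_apply, h a w w' e, smul_eq_mul, smul_eq_mul, mul_left_comm]

/-- Multiplication `𝓞(k)|_p → 𝓞(e + k)|_p` by a homogeneous polynomial of degree `e`. -/
def Twist.mulPoly {e : ℕ} (P : MvPolynomial (Fin (N + 1)) K) (hP : P.IsHomogeneous e) (k : ℤ)
    (p : PP K N) : Twist k p →ₗ[K] Twist ((e : ℤ) + k) p where
  toFun f := ⟨fun w => MvPolynomial.eval w.1.1 P * f.1 w, fun a w w' h => by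
    have h' : (w'.1 : Fin (N + 1) → K) = (a : K) • w.1.1 := congrArg Subtype.val h
    beta_reduce
    rw [f.2 a w w' h, h', eval_smul_of_isHomogeneous hP, zpow_add₀ a.ne_zero, zpow_natCast]
    ring⟩
  map_add' f f' := by ext w; exact mul_add _ _ _
  map_smul' b f := by ext w; exact mul_left_comm _ _ _

/-- The element `z_j^k` of the fibre of `𝓞(k)` at `p`. -/
def Twist.coordPow (k : ℤ) (p : PP K N) (j : Fin (N + 1)) : Twist k p :=
  ⟨fun w => w.1.1 j ^ k, fun a w w' h => by
    have h' : (w'.1 : Fin (N + 1) → K) = (a : K) • w.1.1 := congrArg Subtype.val h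
    beta_reduce
    rw [h', Pi.smul_apply, smul_eq_mul, mul_zpow]⟩

/-- `z` as a nonzero vector of its line. -/
def lineVec' (z : Vec K N) : {w : (proj z).submodule // w ≠ 0} :=
  ⟨lineVec z, fun h => z.2 (congrArg Subtype.val h)⟩

/-- Evaluation at `z` of the elements of the fibre of `𝓞(k)` at `[z]`. -/
def Twist.evalAt (k : ℤ) (z : Vec K N) : Twist k (proj z) →ₗ[K] K :=
  (LinearMap.proj (lineVec' z)).comp (Submodule.subtype _)

/-- The differential at `[z]` of the affine coordinate `z_i / z_j` (where `z_j ≠ 0`), as a linear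
form on `T_V|_[z]`: it takes the class of `(z, [ξ])` to `(z_j ξ_i - z_i ξ_j) / z_j²`. -/
def chartDiff (z : Vec K N) (j i : Fin (N + 1)) : Module.Dual K (tangent G (proj z)) :=
  ((Submodule.liftQ (proj z).submodule
      (((z.1 j ^ 2)⁻¹ : K) • (z.1 j • LinearMap.proj i - z.1 i • LinearMap.proj j :
        Module.Dual K (Fin (N + 1) → K)))
      (by
        intro w hw
        rw [LinearMap.mem_ker]
        obtain ⟨a, rfl⟩ := Submodule.mem_span_singleton.1 hw
        simp only [LinearMap.smul_apply, LinearMap.sub_apply, LinearMap.proj_apply,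
          Pi.smul_apply, smul_eq_mul]
        ring)).comp
    (LinearMap.applyₗ (lineVec z))).comp (Submodule.subtype _)

/-- The fibre at `p` of `Sym^l Ω_V (k) = Sym^l Ω_V ⊗ 𝓞(k)`. -/
def TwistedFibre (l : ℕ) (k : ℤ) (p : PP K N) : Type _ :=
  SymForm K l (tangent G p) ⊗[K] Twist k p

instance (l : ℕ) (k : ℤ) (p : PP K N) : AddCommGroup (TwistedFibre G l k p) :=
  inferInstanceAs (AddCommGroup (SymForm K l (tangent G p) ⊗[K] Twist k p))

instance (l : ℕ) (k : ℤ) (p : PP K N) : Module K (TwistedFibre G l k p) :=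
  inferInstanceAs (Module K (SymForm K l (tangent G p) ⊗[K] Twist k p))

/-- The element `s ⊗ f` of the fibre of `Sym^l Ω_V ⊗ 𝓞(k)`. -/
def TwistedFibre.tmul {l : ℕ} {k : ℤ} {p : PP K N} (s : SymForm K l (tangent G p))
    (f : Twist k p) : TwistedFibre G l k p :=
  TensorProduct.tmul K s f

/-- The monomial form `d(z_{α_1} / z_j) ⋯ d(z_{α_l} / z_j) ⊗ z_j^k` at `[z]`. -/
def chartMonomial {l : ℕ} (k : ℤ) (z : Vec K N) (j : Fin (N + 1)) (α : Fin l → Fin (N + 1)) :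
    TwistedFibre G l k (proj z) :=
  TwistedFibre.tmul G (SymForm.prod fun m => chartDiff G z j (α m)) (Twist.coordPow k (proj z) j)

/-- Regularity of a family `σ` of elements of the fibres of `Sym^l Ω_V (k)`, indexed by a Zariski
locally closed subset `Y` of `V = {G = 0}`: on `Y ∩ {z_j ≠ 0}` the family is Zariski-locally of
the form `∑_α (H_α / g) d(z_{α_1} / z_j) ⋯ d(z_{α_l} / z_j) ⊗ z_j^k`, where `H_α` and `g` are
homogeneous polynomials of one and the same degree. -/
def IsRegular {l : ℕ} {k : ℤ} {Y : Set (PP K N)} (σ : (p : Y) → TwistedFibre G l k p.1) : Prop :=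
  ∀ (z₀ : cone Y) (j : Fin (N + 1)), z₀.1.1 j ≠ 0 →
    ∃ (e : ℕ) (g : MvPolynomial (Fin (N + 1)) K)
      (H : (Fin l → Fin (N + 1)) → MvPolynomial (Fin (N + 1)) K),
      g.IsHomogeneous e ∧ (∀ α, (H α).IsHomogeneous e) ∧ MvPolynomial.eval z₀.1.1 g ≠ 0 ∧
      ∀ z : cone Y, z.1.1 j ≠ 0 → MvPolynomial.eval z.1.1 g ≠ 0 →
        σ ⟨proj z.1, z.2⟩ =
          ∑ α, (MvPolynomial.eval z.1.1 (H α) / MvPolynomial.eval z.1.1 g) •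
            chartMonomial G k z.1 j α

theorem IsRegular.add {l : ℕ} {k : ℤ} {Y : Set (PP K N)}
    {σ σ' : (p : Y) → TwistedFibre G l k p.1} (h : IsRegular G σ) (h' : IsRegular G σ') :
    IsRegular G (σ + σ') := by
  intro z₀ j hj
  obtain ⟨e, g, H, hge, hHe, hg, hH⟩ := h z₀ j hj
  obtain ⟨e', g', H', hge', hHe', hg', hH'⟩ := h' z₀ j hj
  refine ⟨e + e', g * g', fun α => H α * g' + g * H' α, hge.mul hge', fun α => ?_, ?_,
    fun z hz hz' => ?_⟩
  · exact ((hHe α).mul hge').add (hge.mul (hHe' α))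
  · rw [map_mul]
    exact mul_ne_zero hg hg'
  · rw [map_mul] at hz'
    have h1 := left_ne_zero_of_mul hz'
    have h2 := right_ne_zero_of_mul hz'
    have h3 : (σ + σ') ⟨proj z.1, z.2⟩ = σ ⟨proj z.1, z.2⟩ + σ' ⟨proj z.1, z.2⟩ := rfl
    rw [h3, hH z hz h1, hH' z hz h2, ← Finset.sum_add_distrib]
    refine Finset.sum_congr rfl fun α _ => ?_
    rw [← add_smul, div_add_div _ _ h1 h2]
    simp only [map_add, map_mul]

theorem IsRegular.smul {l : ℕ} {k : ℤ} {Y : Set (PP K N)} (a : K)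
    {σ : (p : Y) → TwistedFibre G l k p.1} (h : IsRegular G σ) : IsRegular G (a • σ) := by
  intro z₀ j hj
  obtain ⟨e, g, H, hge, hHe, hg, hH⟩ := h z₀ j hj
  refine ⟨e, g, fun α => MvPolynomial.C a * H α, hge, fun α => ?_, hg, fun z hz hz' => ?_⟩
  · simpa using (MvPolynomial.isHomogeneous_C _ a).mul (hHe α)
  · have h3 : (a • σ) ⟨proj z.1, z.2⟩ = a • σ ⟨proj z.1, z.2⟩ := rfl
    rw [h3, hH z hz hz', Finset.smul_sum]
    refine Finset.sum_congr rfl fun α _ => ?_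
    rw [smul_smul, map_mul, MvPolynomial.eval_C, mul_div_assoc]

theorem IsRegular.zero {l : ℕ} {k : ℤ} {Y : Set (PP K N)} :
    IsRegular G (0 : (p : Y) → TwistedFibre G l k p.1) :=
  fun _ _ _ => ⟨0, 1, 0, MvPolynomial.isHomogeneous_one _ _,
    fun _ => MvPolynomial.isHomogeneous_zero _ _ _, by simp, fun _ _ _ => by
      simp only [Pi.zero_apply, map_zero, zero_div, zero_smul, Finset.sum_const_zero]⟩

/-- `Γ(Y, Sym^l Ω_V (k))` for a Zariski locally closed subset `Y` of `V = {G = 0}`: the regular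
families of elements of the fibres over the points of `Y`. -/
def TwistedSection (l : ℕ) (k : ℤ) (Y : Set (PP K N)) :
    Submodule K ((p : Y) → TwistedFibre G l k p.1) where
  carrier := {σ | IsRegular G σ}
  add_mem' h h' := IsRegular.add G h h'
  zero_mem' := IsRegular.zero G
  smul_mem' a _ h := IsRegular.smul G a h

/-- Multiplication of a family of elements of the fibres of `Sym^l Ω_V (k)` by a homogeneous
polynomial of degree `e`. -/
def mulPoly {l : ℕ} {k : ℤ} {Y : Set (PP K N)} {e : ℕ} (P : MvPolynomial (Fin (N + 1)) K)
    (hP : P.IsHomogeneous e) (σ : (p : Y) → TwistedFibre G l k p.1) :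
    (p : Y) → TwistedFibre G l ((e : ℤ) + k) p.1 :=
  fun p => (Twist.mulPoly P hP k p.1).lTensor (SymForm K l (tangent G p.1)) (σ p)

/-! ### The canonical injection -/

/-- The fibre at `z` of the canonical injection: `s ⊗ f` goes to `f(z) · s ∘ dπ_z`. -/
def pullFibre (l : ℕ) (k : ℤ) (z : Vec K N) :
    TwistedFibre G l k (proj z) →ₗ[K] SymForm K l (horTangent G z) :=
  TensorProduct.lift (M := SymForm K l (tangent G (proj z))) (N := Twist k (proj z))
    ((((LinearMap.lsmul K (SymForm K l (horTangent G z))).comp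
      (Twist.evalAt k z)).flip).comp (SymForm.comap (dproj G z)))

theorem pullFibre_tmul (l : ℕ) (k : ℤ) (z : Vec K N) (s : SymForm K l (tangent G (proj z)))
    (f : Twist k (proj z)) :
    pullFibre G l k z (TwistedFibre.tmul G s f) = Twist.evalAt k z f • SymForm.comap (dproj G z) s := rfl

theorem Twist.eq_of_evalAt (k : ℤ) (z : Vec K N) {f f' : Twist k (proj z)}
    (h : Twist.evalAt k z f = Twist.evalAt k z f') : f = f' := by
  ext w
  have hw : w.1 = lineCoord z w.1 • lineVec z := Subtype.ext (lineCoord_smul z w.1).symm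
  have h0 : lineCoord z w.1 ≠ 0 := fun h => w.2 (by rw [hw, h, zero_smul])
  rw [f.2 (Units.mk0 _ h0) (lineVec' z) w hw, f'.2 (Units.mk0 _ h0) (lineVec' z) w hw]
  exact congrArg _ h

theorem Twist.exists_evalAt_eq_one (k : ℤ) (z : Vec K N) :
    ∃ f : Twist k (proj z), Twist.evalAt k z f = 1 := by
  refine ⟨⟨fun w => lineCoord z w.1 ^ k, fun a w w' h => ?_⟩, ?_⟩
  · beta_reduce
    rw [h, map_smul, smul_eq_mul, mul_zpow]
  · change lineCoord z (lineVec z) ^ k = 1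
    rw [lineCoord_lineVec, one_zpow]

theorem pullFibre_injective (l : ℕ) (k : ℤ) (z : Vec K N) :
    Function.Injective (pullFibre G l k z) := by
  obtain ⟨f₀, hf₀⟩ := Twist.exists_evalAt_eq_one k z
  have key : ∀ x : TwistedFibre G l k (proj z), ∃ s, x = TwistedFibre.tmul G s f₀ := by
    intro x
    refine TensorProduct.induction_on (motive := fun x : TwistedFibre G l k (proj z) =>
      ∃ s, x = TwistedFibre.tmul G s f₀) x ⟨0, ?_⟩ (fun s f => ⟨Twist.evalAt k z f • s, ?_⟩) ?_
    · exact (TensorProduct.zero_tmul _ _).symm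
    · have : f = Twist.evalAt k z f • f₀ := Twist.eq_of_evalAt k z (by simp [hf₀])
      conv_lhs => rw [this]
      exact (TensorProduct.smul_tmul _ s f₀).symm
    · rintro x y ⟨s, rfl⟩ ⟨s', rfl⟩
      exact ⟨s + s', (TensorProduct.add_tmul _ _ _).symm⟩
  intro x y h
  obtain ⟨s, rfl⟩ := key x
  obtain ⟨s', rfl⟩ := key y
  rw [pullFibre_tmul, pullFibre_tmul, hf₀, one_smul, one_smul] at h
  rw [SymForm.comap_injective _ (dproj_surjective G z) h]

theorem pullFibre_chartMonomial {l : ℕ} (k : ℤ) (z : Vec K N) (j : Fin (N + 1))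
    (α : Fin l → Fin (N + 1)) (ξ : affineTangent G z.1) :
    (pullFibre G l k z (chartMonomial G k z j α)).1 (horClass G z ξ) =
      z.1 j ^ k * ∏ m, ((z.1 j ^ 2)⁻¹ * (z.1 j * ξ.1 (α m) - z.1 (α m) * ξ.1 j)) := by
  have h : ∀ i, chartDiff G z j i (dproj G z (horClass G z ξ)) =
      (z.1 j ^ 2)⁻¹ * (z.1 j * ξ.1 i - z.1 i * ξ.1 j) := by
    intro i
    have h0 : (dproj G z (horClass G z ξ)).1 (lineVec z) = (proj z).submodule.mkQ ξ.1 := by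
      change lineCoord z (lineVec z) • (proj z).submodule.mkQ ξ.1 = _
      rw [lineCoord_lineVec, one_smul]
    simp only [chartDiff, LinearMap.comp_apply, Submodule.subtype_apply, LinearMap.applyₗ_apply_apply]
    rw [h0, Submodule.mkQ_apply, Submodule.liftQ_apply]
    rfl
  change z.1 j ^ k * ∏ m, chartDiff G z j (α m) (dproj G z (horClass G z ξ)) = _
  simp only [h]

theorem pull_mem (l : ℕ) (k : ℤ) (Y : Set (PP K N)) (σ : TwistedSection G l k Y) :
    (fun z : cone Y => pullFibre G l k z.1 (σ.1 ⟨proj z.1, z.2⟩)) ∈ HorSection G l (cone Y) := by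
  classical
  intro z₀
  obtain ⟨j, hj⟩ : ∃ j, z₀.1.1 j ≠ 0 := Function.ne_iff.1 z₀.1.2
  obtain ⟨e, g, H, -, -, hg, hH⟩ := σ.2 z₀ j hj
  let c : Fin (N + 1) → Fin (N + 1) → MvPolynomial (Fin (N + 1)) K := fun i b =>
    (if b = i then MvPolynomial.X j else 0) - (if b = j then MvPolynomial.X i else 0)
  refine ⟨g * MvPolynomial.X j ^ (2 * l + (-k).toNat + 1),
    fun β => ∑ α, H α * MvPolynomial.X j ^ (k.toNat + 1) * ∏ m, c (α m) (β m), ?_,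
    fun z hz ξ => ?_⟩
  · rw [map_mul, map_pow, MvPolynomial.eval_X]
    exact mul_ne_zero hg (pow_ne_zero _ hj)
  · rw [map_mul, map_pow, MvPolynomial.eval_X] at hz
    have hgz := left_ne_zero_of_mul hz
    have hjz : z.1.1 j ≠ 0 := fun h => right_ne_zero_of_mul hz (by rw [h]; simp)
    beta_reduce
    have hc : ∀ i, ∑ b, MvPolynomial.eval z.1.1 (c i b) * ξ.1 b =
        z.1.1 j * ξ.1 i - z.1.1 i * ξ.1 j := by
      intro i
      simp only [c, map_sub, apply_ite (MvPolynomial.eval z.1.1), MvPolynomial.eval_X, map_zero,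
        sub_mul, ite_mul, zero_mul, Finset.sum_sub_distrib, Finset.sum_ite_eq',
        Finset.mem_univ, if_true]
    have hp : ∀ α : Fin l → Fin (N + 1),
        ∏ m, (z.1.1 j * ξ.1 (α m) - z.1.1 (α m) * ξ.1 j) =
          ∑ β : Fin l → Fin (N + 1),
            (∏ m, MvPolynomial.eval z.1.1 (c (α m) (β m))) * ∏ m, ξ.1 (β m) := by
      intro α
      simp only [← hc, Finset.prod_univ_sum, Fintype.piFinset_univ, Finset.prod_mul_distrib]
    have hzk : z.1.1 j ^ k * z.1.1 j ^ (-k).toNat = z.1.1 j ^ k.toNat := by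
      rw [← zpow_natCast, ← zpow_natCast, ← zpow_add₀ hjz]
      congr 1
      omega
    rw [hH z hjz hgz, map_sum]
    have hs : ∀ f : (Fin l → Fin (N + 1)) → SymForm K l (horTangent G z.1),
        (∑ α, f α).1 (horClass G z.1 ξ) = ∑ α, (f α).1 (horClass G z.1 ξ) := by
      intro f
      rw [AddSubmonoidClass.coe_finsetSum, Finset.sum_apply]
    rw [hs, eq_div_iff (by rwa [map_mul, map_pow, MvPolynomial.eval_X])]
    simp only [map_sum, Finset.sum_mul]
    rw [Finset.sum_comm]
    refine Finset.sum_congr rfl fun α _ => ?_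
    have h1 : (pullFibre G l k z.1 ((MvPolynomial.eval z.1.1 (H α) / MvPolynomial.eval z.1.1 g) •
        chartMonomial G k z.1 j α)).1 (horClass G z.1 ξ) =
        (MvPolynomial.eval z.1.1 (H α) / MvPolynomial.eval z.1.1 g) *
          (z.1.1 j ^ k * ∏ m, ((z.1.1 j ^ 2)⁻¹ *
            (z.1.1 j * ξ.1 (α m) - z.1.1 (α m) * ξ.1 j))) := by
      rw [map_smul, ← pullFibre_chartMonomial]
      rfl
    rw [h1]
    simp only [map_mul, map_pow, MvPolynomial.eval_X, map_prod, mul_assoc]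
    rw [← Finset.mul_sum, ← Finset.mul_sum, ← hp, Finset.prod_mul_distrib, Finset.prod_const,
      Finset.card_univ, Fintype.card_fin, pow_succ _ (2 * l + (-k).toNat),
      pow_succ _ k.toNat, ← hzk]
    generalize (∏ m, (z.1.1 j * ξ.1 (α m) - z.1.1 (α m) * ξ.1 j)) = D
    have hl : ((z.1.1 j ^ 2)⁻¹) ^ l * z.1.1 j ^ (2 * l) = 1 := by
      rw [pow_mul, ← mul_pow, inv_mul_cancel₀ (pow_ne_zero _ hjz), one_pow]
    generalize ((z.1.1 j ^ 2)⁻¹) ^ l = u at hl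
    generalize z.1.1 j ^ k = y
    rw [pow_add _ (2 * l), div_mul_eq_mul_div, div_eq_iff hgz]
    linear_combination (MvPolynomial.eval z.1.1 (H α) * y * D * MvPolynomial.eval z.1.1 g *
      z.1.1 j ^ (-k).toNat * z.1.1 j) * hl

/-- The canonical map `Γ(Y, Sym^l Ω_V (k)) → Γ(Ŷ, Sym^l Ω_hor V̂)`. -/
def canonicalMap (l : ℕ) (k : ℤ) (Y : Set (PP K N)) :
    TwistedSection G l k Y →ₗ[K] HorSection G l (cone Y) where
  toFun σ := ⟨fun z => pullFibre G l k z.1 (σ.1 ⟨proj z.1, z.2⟩), pull_mem G l k Y σ⟩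
  map_add' _ _ := Subtype.ext (funext fun z => map_add (pullFibre G l k z.1) _ _)
  map_smul' _ _ := Subtype.ext (funext fun z => map_smul (pullFibre G l k z.1) _ _)

theorem canonicalMap_injective (l : ℕ) (k : ℤ) (Y : Set (PP K N)) :
    Function.Injective (canonicalMap G l k Y) := by
  intro σ σ' h
  refine Subtype.ext (funext fun p => ?_)
  obtain ⟨p, hp⟩ := p
  induction p using Projectivization.ind with
  | h z hz =>
    have := congrFun (congrArg Subtype.val h) ⟨⟨z, hz⟩, hp⟩
    exact pullFibre_injective G l k ⟨z, hz⟩ this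

end Geometry

/-! ### Fermat-type hypersurfaces and the determinants -/

section Fermat

variable {K : Type*} [Field K] {N : ℕ}

/-- The system of Fermat-type polynomials `F_i = ∑_j A_i^j z_j^{λ_j}`, where all the terms
`A_i^j z_j^{λ_j}` of `F_i` are homogeneous with `deg A_i^j + λ_j = d_i`. -/
def fermatSystem {s : ℕ} (d : Fin s → ℕ) (lam : Fin (N + 1) → ℕ)
    (A : Fin s → Fin (N + 1) → MvPolynomial (Fin (N + 1)) K)
    (hA : ∀ i j, ∃ e, e + lam j = d i ∧ (A i j).IsHomogeneous e) : System K N (Fin s) where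
  poly i := ∑ j, A i j * MvPolynomial.X j ^ lam j
  deg := d
  isHomogeneous i := by
    refine MvPolynomial.IsHomogeneous.sum _ _ _ fun j _ => ?_
    obtain ⟨e, he, h⟩ := hA i j
    rw [← he]
    simpa using h.mul ((MvPolynomial.isHomogeneous_X K j).pow (lam j))

/-- The matrix `C` at `(z, ξ)`: its first `c + r` rows are `Ã_i^j = A_i^j z_j` for `i ≤ c + r`, and
its last `c` rows are `B_i^j = z_j dA_i^j + λ_j A_i^j dz_j` for `i ≤ c`. -/
def matC {c r : ℕ} (lam : Fin (N + 1) → ℕ)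
    (A : Fin (c + r) → Fin (N + 1) → MvPolynomial (Fin (N + 1)) K)
    (z ξ : Fin (N + 1) → K) : Matrix (Fin (c + r) ⊕ Fin c) (Fin (N + 1)) K :=
  Matrix.of fun a j => Sum.elim
    (fun i => MvPolynomial.eval z (A i j) * z j)
    (fun i => z j * differential (A (Fin.castAdd r i) j) z ξ +
      (lam j : K) * MvPolynomial.eval z (A (Fin.castAdd r i) j) * ξ j) a

/-- The rows `i_1, …, i_{l₁}` and `c + r + j_1, …, c + r + j_{l₂}` of `C`. -/
def rowIndex {c r l₁ l₂ : ℕ} (i : Fin l₁ → Fin (c + r)) (j : Fin l₂ → Fin c) :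
    Fin (l₁ + l₂) → Fin (c + r) ⊕ Fin c :=
  Fin.addCases (fun p => Sum.inl (i p)) (fun q => Sum.inr (j q))

/-- The value at `(z, ξ)` of `(-1)^t / z_{ρ_t}^{λ_{ρ_t} - 1}` times the determinant of the submatrix
of `C` with rows `i_1, …, i_{l₁}, c + r + j_1, …, c + r + j_{l₂}` and with columns
`ρ_0, …, ρ_{l₁ + l₂}`, the column `ρ_t` being omitted. The entries of the last `l₂` rows are
`1`-forms, so that the determinant is a symmetric form of degree `l₂`. -/
def detForm {c r l₁ l₂ : ℕ} (lam : Fin (N + 1) → ℕ)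
    (A : Fin (c + r) → Fin (N + 1) → MvPolynomial (Fin (N + 1)) K)
    (i : Fin l₁ → Fin (c + r)) (j : Fin l₂ → Fin c) (ρ : Fin (l₁ + l₂ + 1) → Fin (N + 1))
    (t : Fin (l₁ + l₂ + 1)) (z ξ : Fin (N + 1) → K) : K :=
  (-1) ^ (t : ℕ) / z (ρ t) ^ (lam (ρ t) - 1) *
    ((matC lam A z ξ).submatrix (rowIndex i j) fun m => ρ (t.succAbove m)).det

/-- The twist `∑ deg F_{i_p} + ∑ deg F_{j_q} - (∑ λ_j - ∑ λ_{v_μ}) + (N - η) + 1`. -/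
def twistDegree {c r l₁ l₂ η : ℕ} (d : Fin (c + r) → ℕ) (lam : Fin (N + 1) → ℕ)
    (i : Fin l₁ → Fin (c + r)) (j : Fin l₂ → Fin c) (v : Fin η → Fin (N + 1)) : ℤ :=
  ∑ p, (d (i p) : ℤ) + ∑ q, (d (Fin.castAdd r (j q)) : ℤ)
    - (∑ k, (lam k : ℤ) - ∑ μ, (lam (v μ) : ℤ)) + ((N : ℤ) - (η : ℤ)) + 1

end Fermat

end FermatForms
end

/-! Let `z` lie on the cone of `Y` and let `ξ` be tangent to the cone of `V`. Then `F_i(z) = 0` and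
`dF_i(ξ) = 0` say that `∑_k A_i^k z_k · z_k^{λ_k - 1} = 0` and `∑_k (z_k dA_i^k(ξ) + λ_k A_i^k ξ_k)
· z_k^{λ_k - 1} = 0`. So every row of `C` annihilates the vector of the `z_k^{λ_k - 1}`. Since `λ_k
≥ 2`, the entries at the vanishing coordinates are zero and those columns can be dropped
(`matC_submatrix_mulVec_eq_zero`).

What remains is a matrix with one more column than rows and a known kernel vector. By Cramer's rule
(`signed_minor_mul_eq`) its signed maximal minors are proportional to that vector. The quotients of
minor by entry are the forms `ω̂_t`, which therefore agree on overlaps (`detForm_eq_detForm`). Their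
domains cover the cone, because a nonzero `z` has a nonzero coordinate among the `z_{ρ_t}`.

Two properties make the glued form descend to `Y`. It is unchanged under `ξ ↦ ξ + a z`: by Euler's
identity this adds to the row of `1`-forms of index `j_q` the multiple `a · deg F_{j_q}` of the row
`(A_{j_q}^k z_k)`, which is among the chosen rows since the `j_q` are among the `i_p`
(`detForm_add_smul`). And it is locally a quotient of homogeneous expressions, whose degree is the
twist (`isHomogeneous_detCoeff`, `twistDegree_eq`). `exists_twistedSection` turns any function of
`(z, ξ)` with these properties into a twisted form. -/

noncomputable section

namespace FermatForms

/-! ### Linear algebra -/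

section Linear

/-- The signed maximal minors of an `n × (n + 1)` matrix are proportional to every vector in its
kernel. -/
theorem signed_minor_mul_eq {K : Type*} [Field K] {n : ℕ} (M : Matrix (Fin n) (Fin (n + 1)) K)
    (x : Fin (n + 1) → K) (hx : M.mulVec x = 0) (s t : Fin (n + 1)) :
    (-1) ^ (t : ℕ) * (M.submatrix id t.succAbove).det * x s =
      (-1) ^ (s : ℕ) * (M.submatrix id s.succAbove).det * x t := by
  rcases eq_or_ne x 0 with rfl | hx0
  · simp
  -- The adjoined row `x_s e_t - x_t e_s` is orthogonal to `x`, so the square matrix still kills `x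
  -- ≠ 0`. Expanding its zero determinant along this row gives the identity.
  let R : Matrix (Fin (n + 1)) (Fin (n + 1)) K :=
    Matrix.of (Fin.cons (Pi.single t (x s) - Pi.single s (x t)) M)
  have hR : R.det = 0 := by
    refine Matrix.exists_mulVec_eq_zero_iff.1 ⟨x, hx0, ?_⟩
    ext a
    refine Fin.cases ?_ (fun a => ?_) a
    · change (Pi.single t (x s) - Pi.single s (x t)) ⬝ᵥ x = 0
      simp [sub_dotProduct, mul_comm]
    · exact congrFun hx a
  rw [Matrix.det_succ_row_zero] at hR
  have hsub : ∀ m : Fin (n + 1), R.submatrix Fin.succ m.succAbove = M.submatrix id m.succAbove :=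
    fun m => rfl
  have h0 : ∀ m, R 0 m = (Pi.single t (x s) - Pi.single s (x t) : Fin (n + 1) → K) m := fun m => rfl
  simp only [hsub, h0, Pi.sub_apply, mul_sub, sub_mul, Finset.sum_sub_distrib, Pi.single_apply,
    mul_ite, ite_mul, mul_zero, zero_mul, Finset.sum_ite_eq', Finset.mem_univ, if_true] at hR
  linear_combination hR

/-- Adding linear combinations of the first `m` rows to the last `n` rows does not change a
determinant. -/
theorem det_addCases_add_mul {R : Type*} [CommRing R] {m n : ℕ}
    (P : Fin m → Fin (m + n) → R) (Q : Fin n → Fin (m + n) → R) (C : Fin n → Fin m → R) :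
    (Matrix.of (Fin.addCases P (fun q b => Q q b + ∑ p, C q p * P p b) :
      Fin (m + n) → Fin (m + n) → R)).det =
      (Matrix.of (Fin.addCases P Q : Fin (m + n) → Fin (m + n) → R)).det := by
  have key : ∀ S : Fin n → Fin (m + n) → R,
      (Matrix.of (Fin.addCases P S : Fin (m + n) → Fin (m + n) → R)).det =
        ((Matrix.fromRows (Matrix.of P) (Matrix.of S)).submatrix id
          (finSumFinEquiv : Fin m ⊕ Fin n ≃ _)).det := by
    intro S
    rw [← Matrix.det_submatrix_equiv_self (finSumFinEquiv : Fin m ⊕ Fin n ≃ _)]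
    congr 1
    ext a b
    rcases a with a | a
    · exact congrFun (Fin.addCases_left (motive := fun _ => Fin (m + n) → R) a) _
    · exact congrFun (Fin.addCases_right (motive := fun _ => Fin (m + n) → R) a) _
  -- The row operation is left multiplication by a block triangular matrix with identity diagonal
  -- blocks, of determinant `1`.
  have h : Matrix.fromRows (Matrix.of P) (Matrix.of fun q b => Q q b + ∑ p, C q p * P p b) =
      (Matrix.fromBlocks 1 0 (Matrix.of C) 1 : Matrix (Fin m ⊕ Fin n) (Fin m ⊕ Fin n) R) *
        Matrix.fromRows (Matrix.of P) (Matrix.of Q) := by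
    rw [Matrix.fromBlocks_mul_fromRows]
    ext (a | a) b
    · simp
    · simp [Matrix.mul_apply, add_comm]
  have h' : (Matrix.fromRows (Matrix.of P)
      (Matrix.of fun q b => Q q b + ∑ p, C q p * P p b)).submatrix id
        (finSumFinEquiv : Fin m ⊕ Fin n ≃ _) =
      (Matrix.fromBlocks 1 0 (Matrix.of C) 1 : Matrix (Fin m ⊕ Fin n) (Fin m ⊕ Fin n) R) *
        (Matrix.fromRows (Matrix.of P) (Matrix.of Q)).submatrix id
          (finSumFinEquiv : Fin m ⊕ Fin n ≃ _) := by
    rw [h]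
    rfl
  rw [key, key, h', Matrix.det_mul, Matrix.det_fromBlocks_zero₁₂, Matrix.det_one, Matrix.det_one,
    one_mul, one_mul]

/-- Expansion of a determinant whose last `n` rows are linear combinations. -/
theorem det_addCases_sum {R : Type*} [CommRing R] {m n : ℕ} {κ : Type*} [Fintype κ]
    (P : Fin m → Fin (m + n) → R) (B : Fin n → κ → Fin (m + n) → R) (ξ : κ → R) :
    (Matrix.of (Fin.addCases P (fun q b => ∑ k, B q k b * ξ k) :
      Fin (m + n) → Fin (m + n) → R)).det =
      ∑ α : Fin n → κ, (Matrix.of (Fin.addCases P (fun q => B q (α q)) :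
        Fin (m + n) → Fin (m + n) → R)).det * ∏ q, ξ (α q) := by
  classical
  -- For the transpose, the products in the Leibniz formula run over the row index. They split into
  -- the first `m` and the last `n` rows, and the product of sums over the latter expands into a sum
  -- over `α`.
  simp only [← Matrix.det_transpose (Matrix.of _), Matrix.det_apply, Fin.prod_univ_add,
    Matrix.transpose_apply, Matrix.of_apply, Fin.addCases_left, Fin.addCases_right,
    Finset.prod_univ_sum, Fintype.piFinset_univ, Finset.prod_mul_distrib, Finset.mul_sum,
    Finset.smul_sum, Finset.sum_mul]
  rw [Finset.sum_comm]
  refine Finset.sum_congr rfl fun α _ => Finset.sum_congr rfl fun τ _ => ?_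
  rw [smul_mul_assoc, mul_assoc]

/-- When the entry at `(x, y)` has degree `a x - b y`, every term of the Leibniz formula has degree
`∑ a - ∑ b`, whatever the permutation. The degrees are written additively to avoid truncated
subtraction. -/
theorem isHomogeneous_det {R σ : Type*} [CommRing R] {n : ℕ}
    (M : Matrix (Fin n) (Fin n) (MvPolynomial σ R)) (a b : Fin n → ℕ)
    (hM : ∀ x y, ∃ e, e + b y = a x ∧ (M x y).IsHomogeneous e) :
    ∃ e, e + ∑ y, b y = ∑ x, a x ∧ M.det.IsHomogeneous e := by
  choose e he hom using hM
  have hs : ∀ τ : Equiv.Perm (Fin n), ∑ y, e (τ y) y + ∑ y, b y = ∑ x, a x := fun τ => by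
    rw [← Finset.sum_add_distrib, ← Equiv.sum_comp τ a]
    exact Finset.sum_congr rfl fun y _ => he _ _
  refine ⟨∑ y, e y y, hs 1, ?_⟩
  rw [Matrix.det_apply]
  refine MvPolynomial.IsHomogeneous.sum _ _ _ fun τ _ => ?_
  have h := MvPolynomial.IsHomogeneous.prod Finset.univ (fun y => M (τ y) y) _ fun y _ => hom (τ y) y
  rw [Nat.add_right_cancel ((hs τ).trans (hs 1).symm)] at h
  rcases Int.units_eq_one_or (Equiv.Perm.sign τ) with h' | h' <;> rw [h']
  · simpa using h
  · simpa using h.neg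

end Linear

/-! ### Differentials of polynomials -/

section Differential

variable {K : Type*} [Field K] {N : ℕ}

theorem differential_apply (P : MvPolynomial (Fin (N + 1)) K) (z ξ : Fin (N + 1) → K) :
    differential P z ξ = ∑ k, MvPolynomial.eval z (MvPolynomial.pderiv k P) * ξ k := by
  simp [differential]

theorem differential_mul (P Q : MvPolynomial (Fin (N + 1)) K) (z ξ : Fin (N + 1) → K) :
    differential (P * Q) z ξ =
      MvPolynomial.eval z P * differential Q z ξ + MvPolynomial.eval z Q * differential P z ξ := by
  simp only [differential_apply, Derivation.leibniz, map_add, smul_eq_mul, map_mul, Finset.mul_sum,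
    ← Finset.sum_add_distrib]
  exact Finset.sum_congr rfl fun _ _ => by ring

theorem differential_X_pow (j : Fin (N + 1)) (n : ℕ) (z ξ : Fin (N + 1) → K) :
    differential (MvPolynomial.X j ^ n) z ξ = n * z j ^ (n - 1) * ξ j := by
  simp [differential_apply, Derivation.leibniz_pow, MvPolynomial.pderiv_X, Pi.single_apply,
    apply_ite (MvPolynomial.eval z), mul_assoc]

theorem differential_sum {ι : Type*} (s : Finset ι) (P : ι → MvPolynomial (Fin (N + 1)) K)
    (z ξ : Fin (N + 1) → K) :
    differential (∑ a ∈ s, P a) z ξ = ∑ a ∈ s, differential (P a) z ξ := by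
  simp only [differential_apply, map_sum, Finset.sum_mul]
  exact Finset.sum_comm

/-- Euler's identity. -/
theorem differential_self {P : MvPolynomial (Fin (N + 1)) K} {e : ℕ} (hP : P.IsHomogeneous e)
    (z : Fin (N + 1) → K) : differential P z z = e * MvPolynomial.eval z P := by
  have h := congrArg (MvPolynomial.eval z) hP.sum_X_mul_pderiv
  simp only [map_sum, map_mul, MvPolynomial.eval_X, nsmul_eq_mul, map_natCast] at h
  rw [differential_apply, ← h]
  exact Finset.sum_congr rfl fun _ _ => mul_comm _ _

theorem eval_eq_zero_of_mem {ι : Type*} {G : System K N ι} {z : Vec K N}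
    (hz : proj z ∈ G.zeroSet) (a : ι) : MvPolynomial.eval z.1 (G.poly a) = 0 :=
  hz a z.1 (lineVec z).2

theorem mem_affineTangent {ι : Type*} {G : System K N ι} {z ξ : Fin (N + 1) → K} :
    ξ ∈ affineTangent G z ↔ ∀ a, differential (G.poly a) z ξ = 0 := by
  simp [affineTangent]

theorem self_mem_affineTangent {ι : Type*} {G : System K N ι} {z : Vec K N}
    (hz : proj z ∈ G.zeroSet) : z.1 ∈ affineTangent G z.1 :=
  mem_affineTangent.2 fun a => by
    rw [differential_self (G.isHomogeneous a), eval_eq_zero_of_mem hz, mul_zero]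

end Differential

/-! ### Construction of twisted sections -/

section Sections

variable {K : Type*} [Field K] {N : ℕ} {ι : Type*} (G : System K N ι)

/-- The differential of `z_i / z_j` at `p`, computed with a vector `w` of the line of `p`. -/
def lineChartDiff (p : PP K N) (w : p.submodule) (j i : Fin (N + 1)) :
    Module.Dual K (tangent G p) :=
  ((Submodule.liftQ p.submodule
      (((w.1 j ^ 2)⁻¹ : K) • (w.1 j • LinearMap.proj i - w.1 i • LinearMap.proj j :
        Module.Dual K (Fin (N + 1) → K)))
      (by
        intro u hu
        rw [LinearMap.mem_ker]
        induction p using Projectivization.ind with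
        | h z hz =>
          obtain ⟨a, ha⟩ := Submodule.mem_span_singleton.1 hu
          obtain ⟨b, hb⟩ := Submodule.mem_span_singleton.1 w.2
          simp only [LinearMap.smul_apply, LinearMap.sub_apply, LinearMap.proj_apply,
            ← ha, ← hb, Pi.smul_apply, smul_eq_mul]
          ring)).comp
    (LinearMap.applyₗ w)).comp (Submodule.subtype _)

variable {G} in
theorem lineChartDiff_apply {p : PP K N} {w : p.submodule} {φ : tangent G p}
    {ζ : Fin (N + 1) → K} (h : p.submodule.mkQ ζ = φ.1 w) (j i : Fin (N + 1)) :
    lineChartDiff G p w j i φ = (w.1 j ^ 2)⁻¹ * (w.1 j * ζ i - w.1 i * ζ j) := by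
  simp only [lineChartDiff, LinearMap.comp_apply, Submodule.subtype_apply,
    LinearMap.applyₗ_apply_apply]
  rw [← h, Submodule.mkQ_apply, Submodule.liftQ_apply]
  rfl

/-- The expression `(w_j ζ_i - w_i ζ_j) / w_j²` has degree `0` in `(w, ζ)`, and a tangent vector
sends `a • w` to `a` times its value at `w`. -/
theorem lineChartDiff_smul (p : PP K N) (w : p.submodule) {a : K} (ha : a ≠ 0)
    (j i : Fin (N + 1)) : lineChartDiff G p (a • w) j i = lineChartDiff G p w j i := by
  refine LinearMap.ext fun φ => ?_
  obtain ⟨ζ, hζ⟩ := Submodule.mkQ_surjective _ (φ.1 w)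
  have hζ' : p.submodule.mkQ (a • ζ) = φ.1 (a • w) := by rw [map_smul, map_smul, hζ]
  rw [lineChartDiff_apply hζ, lineChartDiff_apply hζ']
  simp only [Submodule.coe_smul, Pi.smul_apply, smul_eq_mul]
  -- If `w_j = 0`, both sides vanish by the convention `0⁻¹ = 0`.
  by_cases hw : w.1 j = 0
  · simp [hw]
  · field_simp

/-- The monomial form `d(z_{α_1} / z_j) ⋯ d(z_{α_l} / z_j) ⊗ z_j^k` at `p`, computed with a vector
of the line of `p`. -/
def lineChartMonomial {l : ℕ} (k : ℤ) (p : PP K N) (w : p.submodule) (j : Fin (N + 1))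
    (α : Fin l → Fin (N + 1)) : TwistedFibre G l k p :=
  TwistedFibre.tmul G (SymForm.prod fun m => lineChartDiff G p w j (α m)) (Twist.coordPow k p j)

/-- The left-hand side makes sense at any point `p` with a vector of its line. This allows transport
along an equality of points, which `chartMonomial`, tied to the representative `z`, does not. -/
theorem lineChartMonomial_eq {l : ℕ} (k : ℤ) (z : Vec K N) (w : (proj z).submodule) (hw : w ≠ 0)
    (j : Fin (N + 1)) (α : Fin l → Fin (N + 1)) :
    lineChartMonomial G k (proj z) w j α = chartMonomial G k z j α := by
  have h : lineCoord z w • lineVec z = w := Subtype.ext (lineCoord_smul z w)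
  have h0 : lineCoord z w ≠ 0 := fun h0 => hw (by rw [← h, h0, zero_smul])
  rw [← h]
  simp only [lineChartMonomial, lineChartDiff_smul G _ _ h0]
  rfl

theorem pullFibre_sum_chartMonomial {l : ℕ} (k : ℤ) (z : Vec K N) (j : Fin (N + 1))
    (c : (Fin l → Fin (N + 1)) → K) (ξ : affineTangent G z.1) :
    (pullFibre G l k z (∑ α, c α • chartMonomial G k z j α)).1 (horClass G z ξ) =
      ∑ α, c α * (z.1 j ^ k * ∏ m, ((z.1 j ^ 2)⁻¹ *
        (z.1 j * ξ.1 (α m) - z.1 (α m) * ξ.1 j))) := by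
  rw [map_sum, AddSubmonoidClass.coe_finsetSum, Finset.sum_apply]
  refine Finset.sum_congr rfl fun α _ => ?_
  rw [map_smul, ← pullFibre_chartMonomial]
  rfl

theorem ext_horClass {l : ℕ} {z : Vec K N} {s s' : SymForm K l (horTangent G z)}
    (h : ∀ ξ, s.1 (horClass G z ξ) = s'.1 (horClass G z ξ)) : s = s' := by
  ext t
  obtain ⟨ξ, hξ, ht⟩ := t.2
  have : t = horClass G z ⟨ξ, hξ⟩ := Subtype.ext ht.symm
  rw [this]
  exact h _

variable {G}

/-- A function of `(z, ξ)` on the cone of `Y`, invariant under `ξ ↦ ξ + a z` and locally of the form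
`(∑_α H_α(z) ξ_{α_1} ⋯ ξ_{α_l}) / g(z)` with homogeneous `H_α` and `g`, comes from a section of
`Sym^l Ω_V (k)` with `k = deg H_α + l - deg g`. -/
theorem exists_twistedSection {l : ℕ} {k : ℤ} {Y : Set (PP K N)} (hY : Y ⊆ G.zeroSet)
    (f : (z : cone Y) → affineTangent G z.1.1 → K)
    (hinv : ∀ (z : cone Y) (a : K) (ξ ξ' : affineTangent G z.1.1),
      ξ'.1 = ξ.1 + a • z.1.1 → f z ξ' = f z ξ)
    (hloc : ∀ z₀ : cone Y, ∃ (a b : ℕ) (g : MvPolynomial (Fin (N + 1)) K)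
      (H : (Fin l → Fin (N + 1)) → MvPolynomial (Fin (N + 1)) K),
      (b : ℤ) + l = a + k ∧ g.IsHomogeneous a ∧ (∀ α, (H α).IsHomogeneous b) ∧
      MvPolynomial.eval z₀.1.1 g ≠ 0 ∧
      ∀ z : cone Y, MvPolynomial.eval z.1.1 g ≠ 0 → ∀ ξ : affineTangent G z.1.1,
        f z ξ = (∑ α, MvPolynomial.eval z.1.1 (H α) * ∏ m, ξ.1 (α m)) /
          MvPolynomial.eval z.1.1 g) :
    ∃ σ : TwistedSection G l k Y, ∀ (z : cone Y) (ξ : affineTangent G z.1.1),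
      HorSection.val G (canonicalMap G l k Y σ) z ξ = f z ξ := by
  have hchart : ∀ (z₀ : cone Y) (j : Fin (N + 1)), z₀.1.1 j ≠ 0 →
      ∃ (e : ℕ) (g : MvPolynomial (Fin (N + 1)) K)
        (H : (Fin l → Fin (N + 1)) → MvPolynomial (Fin (N + 1)) K),
        g.IsHomogeneous e ∧ (∀ α, (H α).IsHomogeneous e) ∧ MvPolynomial.eval z₀.1.1 g ≠ 0 ∧
        ∀ z : cone Y, z.1.1 j ≠ 0 → MvPolynomial.eval z.1.1 g ≠ 0 →
          ∀ ξ : affineTangent G z.1.1, (pullFibre G l k z.1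
            (∑ α, (MvPolynomial.eval z.1.1 (H α) / MvPolynomial.eval z.1.1 g) •
              chartMonomial G k z.1 j α)).1 (horClass G z.1 ξ) = f z ξ := by
    intro z₀ j hj
    obtain ⟨a, b, g, H, hab, hg, hH, hg₀, hf⟩ := hloc z₀
    -- The factors `z_j^a` and `z_j^b` give numerator and denominator the common degree `a + b`. As
    -- `b + l = a + k`, multiplying by `z_j^k` leaves `H_α z_j^l / g`, and `z_j^l` is absorbed by
    -- the `l` differentials.
    refine ⟨a + b, g * MvPolynomial.X j ^ b, fun α => H α * MvPolynomial.X j ^ a,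
      hg.mul (MvPolynomial.isHomogeneous_X_pow j b), fun α => ?_, ?_, fun z hz hgz ξ => ?_⟩
    · have h := (hH α).mul (MvPolynomial.isHomogeneous_X_pow j a)
      rwa [add_comm b a] at h
    · simpa using ⟨hg₀, fun h => absurd h hj⟩
    · have hgz' : MvPolynomial.eval z.1.1 g ≠ 0 := by
        rw [map_mul] at hgz
        exact left_ne_zero_of_mul hgz
      -- The multiple of `z` is chosen so that `ξ'_j = 0`. The coordinates of `ξ'` are then `z_j ·
      -- d(z_i / z_j)(ξ)`.
      let ξ' : affineTangent G z.1.1 :=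
        ξ + (-(ξ.1 j / z.1.1 j)) • ⟨z.1.1, self_mem_affineTangent (hY z.2)⟩
      have hξ' : ∀ i, ξ'.1 i = (z.1.1 j)⁻¹ * (z.1.1 j * ξ.1 i - z.1.1 i * ξ.1 j) := fun i => by
        change ξ.1 i + -(ξ.1 j / z.1.1 j) * z.1.1 i = _
        field_simp
        ring
      rw [pullFibre_sum_chartMonomial, ← hinv z (-(ξ.1 j / z.1.1 j)) ξ ξ' rfl, hf z hgz',
        Finset.sum_div]
      refine Finset.sum_congr rfl fun α _ => ?_
      simp only [hξ', Finset.prod_mul_distrib, Finset.prod_const, Finset.card_univ,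
        Fintype.card_fin, map_mul, map_pow, MvPolynomial.eval_X]
      generalize (∏ m, (z.1.1 j * ξ.1 (α m) - z.1.1 (α m) * ξ.1 j)) = D
      have hk : z.1.1 j ^ k = z.1.1 j ^ b * z.1.1 j ^ l / z.1.1 j ^ a := by
        rw [eq_div_iff (pow_ne_zero _ hz), ← zpow_natCast, ← zpow_natCast, ← zpow_natCast,
          ← zpow_add₀ hz, ← zpow_add₀ hz, hab, add_comm k]
      have hl : ((z.1.1 j ^ 2)⁻¹) ^ l = (z.1.1 j ^ l)⁻¹ * (z.1.1 j ^ l)⁻¹ := by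
        rw [inv_pow, ← mul_inv, ← mul_pow, sq]
      have hzl := pow_ne_zero l hz
      rw [hk, hl, inv_pow]
      field_simp
  -- One element of the fibre at `p` must serve all representatives `z` of `p`. It does so because
  -- its coefficients are quotients of degree `0`.
  have hfib : ∀ p ∈ Y, ∃ x : TwistedFibre G l k p, ∀ (z : cone Y) (h : p = proj z.1)
      (ξ : affineTangent G z.1.1), (pullFibre G l k z.1 (h ▸ x)).1 (horClass G z.1 ξ) = f z ξ := by
    intro p
    induction p using Projectivization.ind with
    | h v hv =>
      intro hp
      let z₀ : cone Y := ⟨⟨v, hv⟩, hp⟩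
      obtain ⟨j, hj⟩ : ∃ j, v j ≠ 0 := Function.ne_iff.1 hv
      obtain ⟨e, g, H, hg, hH, hg₀, hf⟩ := hchart z₀ j hj
      have hw₀ : lineVec z₀.1 ≠ 0 := (lineVec' z₀.1).2
      refine ⟨∑ α, (MvPolynomial.eval v (H α) / MvPolynomial.eval v g) •
        lineChartMonomial G k (proj z₀.1) (lineVec z₀.1) j α, fun z h ξ => ?_⟩
      obtain ⟨a, ha⟩ : ∃ a : Kˣ, a • z.1.1 = v := (Projectivization.mk_eq_mk_iff K _ _ _ _).1 h
      have ha' : v = (a : K) • z.1.1 := ha.symm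
      have hzj : z.1.1 j ≠ 0 := fun h0 => hj (by rw [ha', Pi.smul_apply, h0, smul_zero])
      have hgz : MvPolynomial.eval z.1.1 g ≠ 0 := fun h0 => hg₀ (by
        change MvPolynomial.eval v g = 0
        rw [ha', eval_smul_of_isHomogeneous hg, h0, mul_zero])
      have hc : ∀ α, MvPolynomial.eval v (H α) / MvPolynomial.eval v g =
          MvPolynomial.eval z.1.1 (H α) / MvPolynomial.eval z.1.1 g := fun α => by
        rw [ha', eval_smul_of_isHomogeneous hg, eval_smul_of_isHomogeneous (hH α),
          mul_div_mul_left _ _ (pow_ne_zero _ a.ne_zero)]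
      rw [← hf z hzj hgz ξ]
      simp only [hc]
      -- The point `p` is generalized so that the equality `p = proj z` can be eliminated by
      -- substitution.
      have key : ∀ (p : PP K N) (w : p.submodule) (hw : w ≠ 0) (h : p = proj z.1)
          (c : (Fin l → Fin (N + 1)) → K),
          h ▸ (∑ α, c α • lineChartMonomial G k p w j α) =
            ∑ α, c α • chartMonomial G k z.1 j α := by
        intro p w hw h c
        subst h
        exact Finset.sum_congr rfl fun α _ => by rw [lineChartMonomial_eq G k z.1 w hw]
      exact congrArg (fun x => (pullFibre G l k z.1 x).1 (horClass G z.1 ξ)) (key _ _ hw₀ h _)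
  choose x hx using hfib
  have hx' : ∀ (z : cone Y) (ξ : affineTangent G z.1.1),
      (pullFibre G l k z.1 (x (proj z.1) z.2)).1 (horClass G z.1 ξ) = f z ξ :=
    fun z ξ => hx _ z.2 z rfl ξ
  refine ⟨⟨fun p => x p.1 p.2, fun z₀ j hj => ?_⟩, hx'⟩
  obtain ⟨e, g, H, hg, hH, hg₀, hf⟩ := hchart z₀ j hj
  refine ⟨e, g, H, hg, hH, hg₀, fun z hz hgz => ?_⟩
  -- The chosen elements are determined by their pull-backs, so the local formulas hold for them
  -- too.
  refine pullFibre_injective G l k z.1 (ext_horClass G fun ξ => ?_)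
  rw [hf z hz hgz ξ]
  exact hx' z ξ

/-- Multiplication of the elements of a fibre of `Sym^l Ω_V (k)` by a homogeneous polynomial. -/
def mulPolyFibre {e : ℕ} (P : MvPolynomial (Fin (N + 1)) K) (hP : P.IsHomogeneous e) (l : ℕ) (k : ℤ)
    (p : PP K N) : TwistedFibre G l k p →ₗ[K] TwistedFibre G l ((e : ℤ) + k) p :=
  (Twist.mulPoly P hP k p).lTensor (SymForm K l (tangent G p))

/-- Only the twist changes: `P z_j^k = (P / z_j^e) z_j^{e + k}`, with a coefficient of degree `0`.
-/
theorem mulPolyFibre_chartMonomial {l : ℕ} {k : ℤ} {e : ℕ} (P : MvPolynomial (Fin (N + 1)) K)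
    (hP : P.IsHomogeneous e) (z : Vec K N) (j : Fin (N + 1)) (hj : z.1 j ≠ 0)
    (α : Fin l → Fin (N + 1)) :
    mulPolyFibre P hP l k (proj z) (chartMonomial G k z j α) =
      (MvPolynomial.eval z.1 P / z.1 j ^ e) • chartMonomial G ((e : ℤ) + k) z j α := by
  have h : Twist.mulPoly P hP k (proj z) (Twist.coordPow k (proj z) j) =
      (MvPolynomial.eval z.1 P / z.1 j ^ e) • Twist.coordPow ((e : ℤ) + k) (proj z) j := by
    refine Twist.eq_of_evalAt _ z ?_
    rw [map_smul]
    change MvPolynomial.eval z.1 P * z.1 j ^ k =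
      (MvPolynomial.eval z.1 P / z.1 j ^ e) * z.1 j ^ ((e : ℤ) + k)
    rw [zpow_add₀ hj, zpow_natCast]
    field_simp
  refine (LinearMap.lTensor_tmul _ _ _ _).trans ?_
  rw [h]
  exact TensorProduct.tmul_smul _ _ _

theorem IsRegular.mulPoly {l : ℕ} {k : ℤ} {Y : Set (PP K N)} {e : ℕ}
    (P : MvPolynomial (Fin (N + 1)) K) (hP : P.IsHomogeneous e)
    {σ : (p : Y) → TwistedFibre G l k p.1} (h : IsRegular G σ) :
    IsRegular G (FermatForms.mulPoly G P hP σ) := by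
  intro z₀ j hj
  obtain ⟨a, g, H, hg, hH, hg₀, hσ⟩ := h z₀ j hj
  refine ⟨a + e, g * MvPolynomial.X j ^ e, fun α => H α * P,
    hg.mul (MvPolynomial.isHomogeneous_X_pow j e), fun α => (hH α).mul hP, ?_,
    fun z hz hgz => ?_⟩
  · simpa using ⟨hg₀, fun h => absurd h hj⟩
  · rw [map_mul] at hgz
    change mulPolyFibre P hP l k (proj z.1) (σ ⟨proj z.1, z.2⟩) = _
    rw [hσ z hz (left_ne_zero_of_mul hgz), map_sum]
    refine Finset.sum_congr rfl fun α _ => ?_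
    rw [map_smul, mulPolyFibre_chartMonomial P hP z.1 j hz α, smul_smul, div_mul_div_comm]
    simp only [map_mul, map_pow, MvPolynomial.eval_X]

theorem pullFibre_mulPolyFibre {l : ℕ} {k : ℤ} {e : ℕ} (P : MvPolynomial (Fin (N + 1)) K)
    (hP : P.IsHomogeneous e) (z : Vec K N) (x : TwistedFibre G l k (proj z)) :
    pullFibre G l ((e : ℤ) + k) z (mulPolyFibre P hP l k (proj z) x) =
      MvPolynomial.eval z.1 P • pullFibre G l k z x := by
  suffices h : (pullFibre G l ((e : ℤ) + k) z).comp (mulPolyFibre P hP l k (proj z)) =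
      MvPolynomial.eval z.1 P • pullFibre G l k z from LinearMap.congr_fun h x
  refine TensorProduct.ext' fun s f => ?_
  change (MvPolynomial.eval z.1 P * Twist.evalAt k z f) • SymForm.comap (dproj G z) s =
    MvPolynomial.eval z.1 P • (Twist.evalAt k z f • SymForm.comap (dproj G z) s)
  rw [mul_smul]

end Sections

/-! ### The determinants as regular forms -/

section Determinants

variable {K : Type*} [Field K] {N c r l₁ l₂ : ℕ} {d : Fin (c + r) → ℕ} {lam : Fin (N + 1) → ℕ}
  {A : Fin (c + r) → Fin (N + 1) → MvPolynomial (Fin (N + 1)) K}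

/-- The coefficient of `ξ_k` in `z_b da + λ_b a ξ_b`. -/
def rowCoeff (lam : Fin (N + 1) → ℕ) (a : MvPolynomial (Fin (N + 1)) K) (b k : Fin (N + 1)) :
    MvPolynomial (Fin (N + 1)) K :=
  MvPolynomial.X b * MvPolynomial.pderiv k a + if k = b then (lam b : MvPolynomial _ K) * a else 0

theorem sum_eval_rowCoeff (a : MvPolynomial (Fin (N + 1)) K) (b : Fin (N + 1))
    (z ξ : Fin (N + 1) → K) :
    ∑ k, MvPolynomial.eval z (rowCoeff lam a b k) * ξ k =
      z b * differential a z ξ + (lam b : K) * MvPolynomial.eval z a * ξ b := by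
  simp only [rowCoeff, map_add, map_mul, MvPolynomial.eval_X, apply_ite (MvPolynomial.eval z),
    map_natCast, map_zero, add_mul, ite_mul, zero_mul, Finset.sum_add_distrib, mul_assoc,
    Finset.sum_ite_eq', Finset.mem_univ, if_true, ← Finset.mul_sum, differential_apply]

theorem isHomogeneous_rowCoeff {a : MvPolynomial (Fin (N + 1)) K} {e : ℕ} (ha : a.IsHomogeneous e)
    (b k : Fin (N + 1)) : (rowCoeff lam a b k).IsHomogeneous e := by
  refine MvPolynomial.IsHomogeneous.add ?_ ?_
  -- The derivative has the truncated degree `e - 1`, so multiplying by `z_b` restores `e` only for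
  -- `e > 0`. For `e = 0` the polynomial is constant and its derivative vanishes.
  · rcases Nat.eq_zero_or_pos e with rfl | he
    · obtain ⟨x, rfl⟩ : ∃ x, a = MvPolynomial.C x :=
        ⟨_, MvPolynomial.totalDegree_eq_zero_iff_eq_C.1
          (Nat.le_zero.1 ha.totalDegree_le)⟩
      simpa using MvPolynomial.isHomogeneous_zero _ _ 0
    · have h := (MvPolynomial.isHomogeneous_X K b).mul (ha.pderiv (i := k))
      rwa [Nat.add_sub_cancel' he] at h
  · split_ifs
    · rw [← map_natCast (MvPolynomial.C : K →+* MvPolynomial (Fin (N + 1)) K)]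
      exact ha.C_mul _
    · exact MvPolynomial.isHomogeneous_zero _ _ _

theorem matC_submatrix (i : Fin l₁ → Fin (c + r)) (j : Fin l₂ → Fin c) {κ : Type*}
    (b : κ → Fin (N + 1)) (z ξ : Fin (N + 1) → K) :
    (matC lam A z ξ).submatrix (rowIndex i j) b =
      Matrix.of (Fin.addCases (fun p m => MvPolynomial.eval z (A (i p) (b m)) * z (b m))
        fun q m => z (b m) * differential (A (Fin.castAdd r (j q)) (b m)) z ξ +
          (lam (b m) : K) * MvPolynomial.eval z (A (Fin.castAdd r (j q)) (b m)) * ξ (b m)) := by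
  ext a m
  refine Fin.addCases (fun p => ?_) (fun q => ?_) a <;>
    simp only [Matrix.submatrix_apply, rowIndex, Fin.addCases_left, Fin.addCases_right, matC,
      Matrix.of_apply, Sum.elim_inl, Sum.elim_inr]

/-- The coefficient of `ξ_{α_1} ⋯ ξ_{α_{l₂}}` in the numerator of the determinantal form. -/
def detCoeff (lam : Fin (N + 1) → ℕ)
    (A : Fin (c + r) → Fin (N + 1) → MvPolynomial (Fin (N + 1)) K)
    (i : Fin l₁ → Fin (c + r)) (j : Fin l₂ → Fin c) (ρ : Fin (l₁ + l₂ + 1) → Fin (N + 1))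
    (t : Fin (l₁ + l₂ + 1)) (α : Fin l₂ → Fin (N + 1)) : MvPolynomial (Fin (N + 1)) K :=
  MvPolynomial.C ((-1) ^ (t : ℕ)) * (Matrix.of (Fin.addCases
    (fun p m => A (i p) (ρ (t.succAbove m)) * MvPolynomial.X (ρ (t.succAbove m)))
    fun q m => rowCoeff lam (A (Fin.castAdd r (j q)) (ρ (t.succAbove m))) (ρ (t.succAbove m)) (α q) :
      Fin (l₁ + l₂) → Fin (l₁ + l₂) → MvPolynomial (Fin (N + 1)) K)).det

/-- Multilinearity in the last `l₂` rows, each a linear combination of polynomial rows with weights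
`ξ_k`, gives the shape that regularity demands. -/
theorem detForm_eq_sum_div (i : Fin l₁ → Fin (c + r)) (j : Fin l₂ → Fin c)
    (ρ : Fin (l₁ + l₂ + 1) → Fin (N + 1)) (t : Fin (l₁ + l₂ + 1)) (z ξ : Fin (N + 1) → K) :
    detForm lam A i j ρ t z ξ =
      (∑ α, MvPolynomial.eval z (detCoeff lam A i j ρ t α) * ∏ q, ξ (α q)) /
        MvPolynomial.eval z (MvPolynomial.X (ρ t) ^ (lam (ρ t) - 1)) := by
  rw [detForm, matC_submatrix]
  simp only [← sum_eval_rowCoeff]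
  rw [det_addCases_sum (fun p m => MvPolynomial.eval z (A (i p) (ρ (t.succAbove m))) *
      z (ρ (t.succAbove m)))
    (fun q k m => MvPolynomial.eval z (rowCoeff lam (A (Fin.castAdd r (j q)) (ρ (t.succAbove m)))
      (ρ (t.succAbove m)) k)) ξ, map_pow, MvPolynomial.eval_X, div_mul_eq_mul_div, Finset.mul_sum]
  refine congrArg (· / _) (Finset.sum_congr rfl fun α _ => ?_)
  rw [detCoeff, map_mul, MvPolynomial.eval_C, RingHom.map_det, mul_assoc]
  congr 3
  ext a m
  refine Fin.addCases (fun p => ?_) (fun q => ?_) a <;>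
    simp only [RingHom.mapMatrix_apply, Matrix.map_apply, Matrix.of_apply, Fin.addCases_left,
      Fin.addCases_right, map_mul, MvPolynomial.eval_X]

/-- The entries `A_i^k z_k` have degree `d_i + 1 - λ_k`, and the coefficients of the `1`-forms have
degree `d_i - λ_k`, so `isHomogeneous_det` applies. The degree `b` is the same for all `α`. -/
theorem isHomogeneous_detCoeff (hA : ∀ i j, ∃ e, e + lam j = d i ∧ (A i j).IsHomogeneous e)
    (i : Fin l₁ → Fin (c + r)) (j : Fin l₂ → Fin c) (ρ : Fin (l₁ + l₂ + 1) → Fin (N + 1))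
    (t : Fin (l₁ + l₂ + 1)) :
    ∃ b, b + ∑ m, lam (ρ (t.succAbove m)) =
        ∑ p, (d (i p) + 1) + ∑ q, d (Fin.castAdd r (j q)) ∧
      ∀ α, (detCoeff lam A i j ρ t α).IsHomogeneous b := by
  have key : ∀ α, ∃ b, b + ∑ m, lam (ρ (t.succAbove m)) =
        ∑ p, (d (i p) + 1) + ∑ q, d (Fin.castAdd r (j q)) ∧
      (detCoeff lam A i j ρ t α).IsHomogeneous b := by
    intro α
    obtain ⟨b, hb, h⟩ := isHomogeneous_det (Matrix.of (Fin.addCases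
      (fun p m => A (i p) (ρ (t.succAbove m)) * MvPolynomial.X (ρ (t.succAbove m)))
      fun q m => rowCoeff lam (A (Fin.castAdd r (j q)) (ρ (t.succAbove m)))
        (ρ (t.succAbove m)) (α q) :
      Fin (l₁ + l₂) → Fin (l₁ + l₂) → MvPolynomial (Fin (N + 1)) K))
      (Fin.addCases (fun p => d (i p) + 1) fun q => d (Fin.castAdd r (j q)))
      (fun m => lam (ρ (t.succAbove m))) (fun a m => by
        refine Fin.addCases (fun p => ?_) (fun q => ?_) a
        · obtain ⟨e, he, h⟩ := hA (i p) (ρ (t.succAbove m))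
          refine ⟨e + 1, ?_, ?_⟩
          · simp only [Fin.addCases_left]
            omega
          · simpa only [Matrix.of_apply, Fin.addCases_left] using
              h.mul (MvPolynomial.isHomogeneous_X K _)
        · obtain ⟨e, he, h⟩ := hA (Fin.castAdd r (j q)) (ρ (t.succAbove m))
          refine ⟨e, ?_, ?_⟩
          · simpa only [Fin.addCases_right] using he
          · simpa only [Matrix.of_apply, Fin.addCases_right] using
              isHomogeneous_rowCoeff h _ _)
    simp only [Fin.sum_univ_add, Fin.addCases_left, Fin.addCases_right] at hb
    exact ⟨b, by simpa only [Fin.sum_univ_add] using hb, h.C_mul _⟩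
  choose b hb h using key
  rcases isEmpty_or_nonempty (Fin l₂ → Fin (N + 1)) with hE | ⟨⟨α₀⟩⟩
  · exact (hE.false fun _ => 0).elim
  · refine ⟨b α₀, hb α₀, fun α => ?_⟩
    rw [Nat.add_right_cancel ((hb α₀).trans (hb α).symm)]
    exact h α

/-- The determinantal forms do not change when a multiple of `z` is added to `ξ`. -/
theorem detForm_add_smul (hA : ∀ i j, ∃ e, e + lam j = d i ∧ (A i j).IsHomogeneous e)
    (i : Fin l₁ → Fin (c + r)) (j : Fin l₂ → Fin c)
    (hji : Set.range (fun q => Fin.castAdd r (j q)) ⊆ Set.range i)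
    (ρ : Fin (l₁ + l₂ + 1) → Fin (N + 1)) (t : Fin (l₁ + l₂ + 1)) (z ξ : Fin (N + 1) → K) (a : K) :
    detForm lam A i j ρ t z (ξ + a • z) = detForm lam A i j ρ t z ξ := by
  have hp : ∀ q, ∃ p, i p = Fin.castAdd r (j q) := fun q => hji ⟨q, rfl⟩
  choose p hp using hp
  rw [detForm, detForm, matC_submatrix, matC_submatrix]
  congr 1
  -- By Euler's identity the row of `1`-forms at `ξ = z` has entries `(e + λ_k) A_i^k z_k = d_i
  -- A_i^k z_k`. The added term is thus `a d_i` times the row with index `p q` of the first block.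
  refine Eq.trans ?_ (det_addCases_add_mul _ _
    fun q p' => if p' = p q then a * d (Fin.castAdd r (j q)) else 0)
  congr 2
  funext a' m
  refine Fin.addCases (fun _ => ?_) (fun q => ?_) a'
  · simp only [Fin.addCases_left]
  obtain ⟨e, he, h⟩ := hA (Fin.castAdd r (j q)) (ρ (t.succAbove m))
  simp only [Fin.addCases_right, ite_mul, zero_mul, Finset.sum_ite_eq', Finset.mem_univ, if_true, hp,
    map_add, map_smul, differential_self h, ← he, Pi.add_apply, Pi.smul_apply, smul_eq_mul,
    Nat.cast_add]
  ring

theorem sum_eq_sum_add_sum {M : Type*} [AddCommMonoid M] {η s n : ℕ} {v : Fin η → Fin n}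
    {ρ : Fin s → Fin n} (hv : Function.Injective v) (hρ : Function.Injective ρ)
    (hρv : Set.range ρ = (Set.range v)ᶜ) (f : Fin n → M) :
    ∑ k, f k = ∑ t, f (ρ t) + ∑ μ, f (v μ) := by
  have hb : Function.Bijective (Sum.elim ρ v) := by
    refine ⟨hρ.sumElim hv fun a b h => ?_, ?_⟩
    · exact (hρv ▸ Set.mem_range_self a : ρ a ∈ (Set.range v)ᶜ) ⟨b, h.symm⟩
    · rw [← Set.range_eq_univ, Set.Sum.elim_range, hρv, Set.compl_union_self]
  rw [← (Equiv.ofBijective _ hb).sum_comp, Fintype.sum_sum_type]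
  rfl

/-- On the cone of `X ∩ {z_{v_1} = ⋯ = z_{v_η} = 0}`, the vector of the `z_{ρ_t}^{λ_{ρ_t} - 1}` is in
the kernel of the matrix of which the determinantal forms are the maximal minors. -/
theorem matC_submatrix_mulVec_eq_zero (hlam : ∀ j, 2 ≤ lam j)
    (hA : ∀ i j, ∃ e, e + lam j = d i ∧ (A i j).IsHomogeneous e) {η s : ℕ} {v : Fin η → Fin (N + 1)}
    {ρ : Fin s → Fin (N + 1)} (hv : Function.Injective v) (hρ : Function.Injective ρ)
    (hρv : Set.range ρ = (Set.range v)ᶜ) (i : Fin l₁ → Fin (c + r)) (j : Fin l₂ → Fin c)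
    {z : Vec K N} (hz : proj z ∈ (fermatSystem d lam A hA).zeroSet) (hzv : ∀ μ, z.1 (v μ) = 0)
    {ξ : Fin (N + 1) → K}
    (hξ : ξ ∈ affineTangent ((fermatSystem d lam A hA).reindex (Fin.castAdd r)) z.1) :
    ((matC lam A z.1 ξ).submatrix (rowIndex i j) ρ).mulVec
      (fun t => z.1 (ρ t) ^ (lam (ρ t) - 1)) = 0 := by
  have hpow : ∀ k, z.1 k * z.1 k ^ (lam k - 1) = z.1 k ^ lam k := fun k => by
    rw [← pow_succ', Nat.sub_add_cancel (by linarith [hlam k])]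
  -- The exponent `λ - 1` is positive as `λ ≥ 2`, so omitting the columns `v μ` loses nothing.
  have hzero : ∀ μ, z.1 (v μ) ^ (lam (v μ) - 1) = 0 := fun μ => by
    rw [hzv, zero_pow (by have := hlam (v μ); omega)]
  have hsum : ∀ f : Fin (N + 1) → K, ∑ k, f k * z.1 k ^ (lam k - 1) = 0 →
      ∑ t, f (ρ t) * z.1 (ρ t) ^ (lam (ρ t) - 1) = 0 := fun f hf => by
    rw [sum_eq_sum_add_sum hv hρ hρv] at hf
    simpa [hzero] using hf
  rw [matC_submatrix]
  ext a
  refine Fin.addCases (fun p => ?_) (fun q => ?_) a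
  · simp only [Matrix.mulVec, dotProduct, Matrix.of_apply, Fin.addCases_left, Pi.zero_apply]
    refine hsum (fun k => MvPolynomial.eval z.1 (A (i p) k) * z.1 k) ?_
    have h := eval_eq_zero_of_mem hz (i p)
    simpa only [fermatSystem, map_sum, map_mul, map_pow, MvPolynomial.eval_X, mul_assoc, hpow]
      using h
  · simp only [Matrix.mulVec, dotProduct, Matrix.of_apply, Fin.addCases_right, Pi.zero_apply]
    refine hsum (fun k => z.1 k * differential (A (Fin.castAdd r (j q)) k) z.1 ξ +
      (lam k : K) * MvPolynomial.eval z.1 (A (Fin.castAdd r (j q)) k) * ξ k) ?_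
    -- By the Leibniz rule, `d(A z_k^λ) = (z_k dA + λ A dz_k) z_k^{λ - 1}`. Hence this row of the
    -- product is `dF(ξ)`.
    have h := mem_affineTangent.1 hξ (j q)
    simp only [System.reindex, fermatSystem, differential_sum, differential_mul,
      differential_X_pow, map_pow, MvPolynomial.eval_X] at h
    rw [← h]
    refine Finset.sum_congr rfl fun k _ => ?_
    rw [← hpow k]
    ring

/-- The determinantal forms agree on the intersections of their domains. -/
theorem detForm_eq_detForm (hlam : ∀ j, 2 ≤ lam j)
    (hA : ∀ i j, ∃ e, e + lam j = d i ∧ (A i j).IsHomogeneous e) {η : ℕ} {v : Fin η → Fin (N + 1)}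
    {ρ : Fin (l₁ + l₂ + 1) → Fin (N + 1)} (hv : Function.Injective v) (hρ : Function.Injective ρ)
    (hρv : Set.range ρ = (Set.range v)ᶜ) (i : Fin l₁ → Fin (c + r)) (j : Fin l₂ → Fin c)
    {z : Vec K N} (hz : proj z ∈ (fermatSystem d lam A hA).zeroSet) (hzv : ∀ μ, z.1 (v μ) = 0)
    {ξ : Fin (N + 1) → K}
    (hξ : ξ ∈ affineTangent ((fermatSystem d lam A hA).reindex (Fin.castAdd r)) z.1)
    {s t : Fin (l₁ + l₂ + 1)} (hs : z.1 (ρ s) ≠ 0) (ht : z.1 (ρ t) ≠ 0) :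
    detForm lam A i j ρ s z.1 ξ = detForm lam A i j ρ t z.1 ξ := by
  have h := signed_minor_mul_eq _ _
    (matC_submatrix_mulVec_eq_zero hlam hA hv hρ hρv i j hz hzv hξ) t s
  simp only [Matrix.submatrix_submatrix] at h
  rw [detForm, detForm, div_mul_eq_mul_div, div_mul_eq_mul_div,
    div_eq_div_iff (pow_ne_zero _ hs) (pow_ne_zero _ ht)]
  exact h

end Determinants

/-! ### Gluing -/

/-- The image under the canonical injection of the product with a homogeneous polynomial. -/
theorem exists_val_canonicalMap_mulPoly {K : Type*} [Field K] {N : ℕ} {ι : Type*} (G : System K N ι)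
    {l : ℕ} {k : ℤ} {Y : Set (PP K N)} (σ : TwistedSection G l k Y) {e : ℕ}
    (P : MvPolynomial (Fin (N + 1)) K) (hP : P.IsHomogeneous e) :
    ∃ τ : TwistedSection G l ((e : ℤ) + k) Y, τ.1 = mulPoly G P hP σ.1 ∧
      ∀ (z : cone Y) (ξ : affineTangent G z.1.1),
        HorSection.val G (canonicalMap G l _ Y τ) z ξ =
          MvPolynomial.eval z.1.1 P * HorSection.val G (canonicalMap G l k Y σ) z ξ :=
  ⟨⟨_, IsRegular.mulPoly P hP σ.2⟩, rfl, fun z ξ =>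
    congrArg (fun s => s.1 (horClass G z.1 ξ))
      (pullFibre_mulPolyFibre P hP z.1 (σ.1 ⟨proj z.1, z.2⟩))⟩

/-- A twisted form and its restrictions to a covering of the cone. -/
theorem exists_glued_form {K : Type*} [Field K] {N s : ℕ} {ι : Type*} (G : System K N ι)
    {l : ℕ} {k : ℤ} {Y : Set (PP K N)} (ρ : Fin s → Fin (N + 1))
    (hρ : ∀ z : cone Y, ∃ t, z.1.1 (ρ t) ≠ 0)
    (D : Fin s → (Fin (N + 1) → K) → (Fin (N + 1) → K) → K) (σ : TwistedSection G l k Y)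
    (hσ : ∀ (z : cone Y) (ξ : affineTangent G z.1.1) (t : Fin s), z.1.1 (ρ t) ≠ 0 →
      HorSection.val G (canonicalMap G l k Y σ) z ξ = D t z.1.1 ξ.1) :
    ∃ ωloc : ∀ t : Fin s, HorSection G l (cone Y ∩ {z | z.1 (ρ t) ≠ 0}),
      (∀ (t : Fin s) (z : ↥(cone Y ∩ {z : Vec K N | z.1 (ρ t) ≠ 0}))
        (ξ : affineTangent G z.1.1), HorSection.val G (ωloc t) z ξ = D t z.1.1 ξ.1) ∧
      ∃ ω : HorSection G l (cone Y),
        (∀ ω' : HorSection G l (cone Y),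
          (∀ t, HorSection.restrict G Set.inter_subset_left ω' = ωloc t) ↔ ω' = ω) ∧
        ∃ σ : TwistedSection G l k Y, canonicalMap G l _ Y σ = ω ∧
          ∀ (e : ℕ) (P : MvPolynomial (Fin (N + 1)) K) (hP : P.IsHomogeneous e),
            ∃ τ : TwistedSection G l ((e : ℤ) + k) Y, τ.1 = mulPoly G P hP σ.1 ∧
              ∀ (z : ↥(cone Y)) (ξ : affineTangent G z.1.1),
                HorSection.val G (canonicalMap G l _ Y τ) z ξ =
                  MvPolynomial.eval z.1.1 P * HorSection.val G ω z ξ := by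
  -- The local forms are the restrictions of the pull-back of `σ`, so only uniqueness of the glued
  -- form needs the covering.
  refine ⟨fun t => HorSection.restrict G Set.inter_subset_left (canonicalMap G l k Y σ),
    fun t z ξ => hσ ⟨z.1, z.2.1⟩ ξ t z.2.2, canonicalMap G l k Y σ,
    fun ω' => ⟨fun h => ?_, fun h t => by rw [h]⟩, σ, rfl,
    fun e P hP => exists_val_canonicalMap_mulPoly G σ P hP⟩
  refine Subtype.ext (funext fun z => ?_)
  obtain ⟨t, ht⟩ := hρ z
  exact congrFun (congrArg Subtype.val (h t)) ⟨z.1, z.2, ht⟩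

theorem exists_coord_ne_zero {K : Type*} [Field K] {N η s : ℕ} {v : Fin η → Fin (N + 1)}
    {ρ : Fin s → Fin (N + 1)} (hρv : Set.range ρ = (Set.range v)ᶜ) {Y : Set (PP K N)}
    (z : cone (coordSection v Y)) : ∃ t, z.1.1 (ρ t) ≠ 0 := by
  by_contra! h
  refine z.1.2 (funext fun k => ?_)
  by_cases hk : k ∈ Set.range v
  · obtain ⟨μ, rfl⟩ := hk
    exact z.2.2 μ z.1.1 (lineVec z.1).2
  · obtain ⟨t, rfl⟩ : k ∈ Set.range ρ := hρv ▸ hk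
    exact h t

/-- The total degree in `(z, ξ)` is `b + l₂ - (λ_{ρ_t} - 1)`. The `l₁` factors `z_k`, the `l₂`
factors `ξ_k` and the `1` from the denominator's exponent together give `N - η + 1`. -/
theorem twistDegree_eq {N c r l₁ l₂ η : ℕ} {d : Fin (c + r) → ℕ} {lam : Fin (N + 1) → ℕ}
    (hlam : ∀ j, 2 ≤ lam j) {v : Fin η → Fin (N + 1)} {ρ : Fin (l₁ + l₂ + 1) → Fin (N + 1)}
    (hv : Function.Injective v) (hρ : Function.Injective ρ)
    (hρv : Set.range ρ = (Set.range v)ᶜ) (hl : l₁ + l₂ + η = N) (i : Fin l₁ → Fin (c + r))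
    (j : Fin l₂ → Fin c) (t : Fin (l₁ + l₂ + 1)) {b : ℕ}
    (hb : b + ∑ m, lam (ρ (t.succAbove m)) =
      ∑ p, (d (i p) + 1) + ∑ q, d (Fin.castAdd r (j q))) :
    (b : ℤ) + l₂ = (lam (ρ t) - 1 : ℕ) + twistDegree d lam i j v := by
  have h1 := sum_eq_sum_add_sum hv hρ hρv fun k => (lam k : ℤ)
  rw [Fin.sum_univ_succAbove _ t] at h1
  have h2 := hlam (ρ t)
  have h3 : (N : ℤ) = l₁ + l₂ + η := by rw [← hl]; push_cast; ring
  have h4 := congrArg (Nat.cast : ℕ → ℤ) hb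
  simp only [Finset.sum_add_distrib, Finset.sum_const, Finset.card_univ, Fintype.card_fin,
    smul_eq_mul, mul_one, Nat.cast_add, Nat.cast_sum] at h4
  rw [twistDegree, h1, h3, Nat.cast_sub (by omega), Nat.cast_one]
  linarith

/-- The determinantal forms glue to a twisted symmetric form. -/
theorem exists_twistedSection_detForm {K : Type*} [Field K] {N c r l₁ l₂ η : ℕ}
    {d : Fin (c + r) → ℕ} {lam : Fin (N + 1) → ℕ}
    {A : Fin (c + r) → Fin (N + 1) → MvPolynomial (Fin (N + 1)) K} (hlam : ∀ j, 2 ≤ lam j)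
    (hA : ∀ i j, ∃ e, e + lam j = d i ∧ (A i j).IsHomogeneous e) {v : Fin η → Fin (N + 1)}
    {ρ : Fin (l₁ + l₂ + 1) → Fin (N + 1)} (hv : Function.Injective v) (hρ : Function.Injective ρ)
    (hρv : Set.range ρ = (Set.range v)ᶜ) (hl : l₁ + l₂ + η = N) (i : Fin l₁ → Fin (c + r))
    (j : Fin l₂ → Fin c) (hji : Set.range (fun q => Fin.castAdd r (j q)) ⊆ Set.range i) :
    ∃ σ : TwistedSection ((fermatSystem d lam A hA).reindex (Fin.castAdd r)) l₂
        (twistDegree d lam i j v) (coordSection v (fermatSystem d lam A hA).zeroSet),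
      ∀ (z : cone (coordSection v (fermatSystem d lam A hA).zeroSet))
        (ξ : affineTangent ((fermatSystem d lam A hA).reindex (Fin.castAdd r)) z.1.1)
        (t : Fin (l₁ + l₂ + 1)), z.1.1 (ρ t) ≠ 0 →
        HorSection.val _ (canonicalMap _ l₂ _ _ σ) z ξ = detForm lam A i j ρ t z.1.1 ξ.1 := by
  -- The global function is defined at each `z` through some nonzero coordinate `τ z`. By `hglue`
  -- the choice does not matter.
  choose τ hτ using fun z : cone (coordSection v (fermatSystem d lam A hA).zeroSet) =>
    exists_coord_ne_zero hρv z
  have hglue : ∀ (z : cone (coordSection v (fermatSystem d lam A hA).zeroSet))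
      (ξ : affineTangent ((fermatSystem d lam A hA).reindex (Fin.castAdd r)) z.1.1)
      (t : Fin (l₁ + l₂ + 1)), z.1.1 (ρ t) ≠ 0 →
      detForm lam A i j ρ (τ z) z.1.1 ξ.1 = detForm lam A i j ρ t z.1.1 ξ.1 := fun z ξ t ht =>
    detForm_eq_detForm hlam hA hv hρ hρv i j z.2.1
      (fun μ => z.2.2 μ z.1.1 (lineVec z.1).2) ξ.2 (hτ z) ht
  obtain ⟨σ, hσ⟩ := exists_twistedSection (k := twistDegree d lam i j v)
    (G := (fermatSystem d lam A hA).reindex (Fin.castAdd r))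
    (Y := coordSection v (fermatSystem d lam A hA).zeroSet)
    (fun p hp q => hp.1 _)
    (fun z ξ => detForm lam A i j ρ (τ z) z.1.1 ξ.1)
    (fun z a ξ ξ' h => by
      rw [h]
      exact detForm_add_smul hA i j hji ρ _ _ _ a)
    (fun z₀ => by
      obtain ⟨b, hb, hH⟩ := isHomogeneous_detCoeff hA i j ρ (τ z₀)
      refine ⟨_, b, MvPolynomial.X (ρ (τ z₀)) ^ (lam (ρ (τ z₀)) - 1), detCoeff lam A i j ρ (τ z₀),
        twistDegree_eq hlam hv hρ hρv hl i j (τ z₀) hb,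
        MvPolynomial.isHomogeneous_X_pow _ _, hH, ?_, fun z hz ξ => ?_⟩
      · rw [map_pow, MvPolynomial.eval_X]
        exact pow_ne_zero _ (hτ z₀)
      -- A nonzero power yields a nonzero coordinate only because the exponent `λ - 1` is positive.
      · have hz' : z.1.1 (ρ (τ z₀)) ≠ 0 := fun h => hz (by
          have := hlam (ρ (τ z₀))
          rw [map_pow, MvPolynomial.eval_X, h, zero_pow (by omega)])
        rw [hglue z ξ _ hz', detForm_eq_sum_div])
  exact ⟨σ, fun z ξ t ht => (hσ z ξ).trans (hglue z ξ t ht)⟩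

end FermatForms
end

theorem mainTheorem8 {K : Type*} [Field K] [IsAlgClosed K] {N c r : ℕ}
    (hN : 2 ≤ N) (hNc : N ≤ 2 * c + r) (hcr : c + r + 1 ≤ N)
    -- the Fermat-type polynomials `F_i = ∑_j A_i^j z_j^{λ_j}`, of degree `d_i`
    (d : Fin (c + r) → ℕ) (lam : Fin (N + 1) → ℕ) (hlam : ∀ j, 2 ≤ lam j)
    (A : Fin (c + r) → Fin (N + 1) → MvPolynomial (Fin (N + 1)) K)
    (hA : ∀ i j, ∃ e, e + lam j = d i ∧ (A i j).IsHomogeneous e)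
    -- `X = {F_1 = ⋯ = F_{c+r} = 0}` and `V = {F_1 = ⋯ = F_c = 0}`
    (FX : FermatForms.System K N (Fin (c + r))) (hFX : FX = FermatForms.fermatSystem d lam A hA)
    (FV : FermatForms.System K N (Fin c)) (hFV : FV = FX.reindex (Fin.castAdd r))
    (hX : FX.IsSmoothCompleteIntersection) (hV : FV.IsSmoothCompleteIntersection)
    -- the vanishing coordinates, with `1 ≤ η ≤ n - 1` for `n = N - (c + r)`
    {η : ℕ} (hη : 1 ≤ η) (hηn : η + 1 + (c + r) ≤ N)
    (v : Fin η → Fin (N + 1)) (hv : StrictMono v)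
    -- the rows
    {l₁ l₂ : ℕ} (hl₂ : 1 ≤ l₂) (hl₁ : l₂ ≤ l₁) (hl : l₁ + l₂ + η = N)
    (i : Fin l₁ → Fin (c + r)) (hi : StrictMono i)
    (j : Fin l₂ → Fin c) (hj : StrictMono j)
    (hji : Set.range (fun q => Fin.castAdd r (j q)) ⊆ Set.range i)
    -- the remaining columns, in ascending order
    (ρ : Fin (l₁ + l₂ + 1) → Fin (N + 1)) (hρ : StrictMono ρ)
    (hρv : Set.range ρ = (Set.range v)ᶜ)
    (Y : Set (FermatForms.PP K N)) (hY : Y = FermatForms.coordSection v FX.zeroSet) :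
    -- the forms on the open sets `{z_{ρ_t} ≠ 0}` of the cone of `Y`
    ∃ ωloc : ∀ t : Fin (l₁ + l₂ + 1),
        FermatForms.HorSection FV l₂ (FermatForms.cone Y ∩ {z | z.1 (ρ t) ≠ 0}),
      (∀ (t : Fin (l₁ + l₂ + 1))
        (z : ↥(FermatForms.cone Y ∩ {z : FermatForms.Vec K N | z.1 (ρ t) ≠ 0}))
        (ξ : FermatForms.affineTangent FV z.1.1),
        FermatForms.HorSection.val FV (ωloc t) z ξ =
          FermatForms.detForm lam A i j ρ t z.1.1 ξ.1) ∧
      -- they glue to one and only one form on the cone of `Y`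
      ∃ ω : FermatForms.HorSection FV l₂ (FermatForms.cone Y),
        (∀ ω' : FermatForms.HorSection FV l₂ (FermatForms.cone Y),
          (∀ t, FermatForms.HorSection.restrict FV Set.inter_subset_left ω' = ωloc t) ↔ ω' = ω) ∧
        -- which is the image of a twisted symmetric form on `Y`
        ∃ σ : FermatForms.TwistedSection FV l₂ (FermatForms.twistDegree d lam i j v) Y,
          FermatForms.canonicalMap FV l₂ _ Y σ = ω ∧
          -- multiplication by homogeneous polynomials
          ∀ (e : ℕ) (P : MvPolynomial (Fin (N + 1)) K) (hP : P.IsHomogeneous e),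
            ∃ τ : FermatForms.TwistedSection FV l₂
                ((e : ℤ) + FermatForms.twistDegree d lam i j v) Y,
              τ.1 = FermatForms.mulPoly FV P hP σ.1 ∧
              ∀ (z : ↥(FermatForms.cone Y)) (ξ : FermatForms.affineTangent FV z.1.1),
                FermatForms.HorSection.val FV (FermatForms.canonicalMap FV l₂ _ Y τ) z ξ =
                  MvPolynomial.eval z.1.1 P * FermatForms.HorSection.val FV ω z ξ := by
  subst hFX hFV hY
  obtain ⟨σ, hσ⟩ := FermatForms.exists_twistedSection_detForm hlam hA hv.injective hρ.injective
    hρv hl i j hji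
  exact FermatForms.exists_glued_form _ ρ (FermatForms.exists_coord_ne_zero hρv)
    (FermatForms.detForm lam A i j ρ) σ hσ
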